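/- Let $0<\alpha<1$, let $K\subset\mathbb R^n$ be nonempty, closed and convex with Euclidean projection $P_K$, let $A,\sigma\in\mathbb R^{n\times n}$, $b\in\mathbb R^n$, $\rho\in\mathbb R$, and let $0=t_0<t_1<\dots<t_m$ be finitely many impulse moments. For $T>t_m$ put $t_{m+1}=T$ and consider on $[0,T]$ the impulsive fractional projection network $$ {}^{C}_{0}D^\alpha_t x(t)=-x(t)+P_K\bigl(x(t)-\rho Ax(t)-\rho b\bigr),\qquad x(t_k^+)-x(t_k^-)=U_k(x(t_k))\quad(1\le k\le m),\qquad x(0)=x_0 , $$ where ${}^{C}_{0}D^\alpha_t x(t)=\frac1{\Gamma(1-\alpha)}\int_0^t(t-s)^{-\alpha}x'(s)\,ds$. A solution is a function $x:[0,T]\to\mathbb R^n$ that is absolutely continuous on $[0,t_1]$ and on each $(t_k,t_{k+1}]$, $1\le k\le m$, satisfies $x(0)=x_0$ and the differential equation for almost every $t\in[0,T]$, and for $1\le k\le m$ has one-sided limits at $t_k$ with $x(t_k^-)=x(t_k)$ and $x(t_k^+)=x(t_k)+U_k(x(t_k))$. A point $x^*$ is an equilibrium if $x^*=P_K(x^*-\rho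 Ax^*-\rho b)$ and $U_k(x^*)=0$ for $1\le k\le m$. **Theorem.** Let $x^*$ be an equilibrium and suppose $U_k(x)=-\sigma(x-x^*)$ for $1\le k\le m$. Suppose there are a symmetric positive definite matrix $Q$ and scalars $\rho_1>0$, $0<\eta_1\le 1$ such that $$ \lambda_{\min}\Bigl(-Q^{-1/2}\bigl(-2Q+\rho_1^{-1}Q^2+\rho_1(I-\rho A)^{T}(I-\rho A)\bigr)Q^{-1/2}\Bigr)>0 \quad\text{and}\quad Q^{-1/2}(I-\sigma)^{T}Q(I-\sigma)Q^{-1/2}-\eta_1 I\le 0 , $$ the second inequality being in the sense of symmetric matrices. Then $x^*$ is globally Mittag-Leffler stable: there are constants $\lambda>0$, $p>0$ and a locally Lipschitz function $M:\mathbb R^n\to[0,\infty)$ with $M(0)=0$ such that, for every $T>t_m$, every $x_0\in\mathbb R^n$ and every solution $x$ on $[0,T]$ with $x(0)=x_0$, $$ \|x(t)-x^*\|\le\bigl[M(x_0-x^*)\,E_\alpha(-\lambda t^\alpha)\bigr]^{p}\qquad(0\le t\le T), $$ where $E_\alpha(z)=\sum_{k\ge0}z^k/\Gamma(\alpha k+1)$.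 (The constants $\lambda,p$ and the function $M$ may depend on the network, including the moments $t_1,\dots,t_m$, but not on $x_0$, on the solution or on $T$.) -/

import Mathlib

open Set Filter Topology MeasureTheory
open scoped MatrixOrder

noncomputable section

/-- The one-parameter Mittag-Leffler function `E_α(z) = ∑ z^k / Γ(α k + 1)` at real arguments
(the series converges for every `z` when `α > 0`). -/
def mittagLeffler (α z : ℝ) : ℝ :=
  ∑' k : ℕ, z ^ k / Real.Gamma (α * k + 1)

/-- The Caputo fractional derivative of order `α ∈ (0,1)` with lower terminal `0`:
`(1 / Γ(1-α)) ∫₀ᵗ (t-s)^{-α} x'(s) ds`, where `x'` is the pointwise derivative, which exists almost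
everywhere for piecewise absolutely continuous `x`; jumps of `x` do not contribute. -/
def caputoDeriv {E : Type*} [NormedAddCommGroup E] [NormedSpace ℝ E]
    (α : ℝ) (x : ℝ → E) (t : ℝ) : E :=
  (Real.Gamma (1 - α))⁻¹ • ∫ s in (0 : ℝ)..t, ((t - s) ^ (-α)) • deriv x s

/-- The projection `P_K(y) = argmin_{z ∈ K} ‖y - z‖`. For nonempty closed convex `K` the minimizer
exists and is unique, see `projOnto_spec` and `eq_projOnto`. -/
def projOnto {n : ℕ} (K : Set (EuclideanSpace ℝ (Fin n))) (y : EuclideanSpace ℝ (Fin n)) :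
    EuclideanSpace ℝ (Fin n) :=
  Classical.epsilon fun z => z ∈ K ∧ ∀ w ∈ K, ‖y - z‖ ≤ ‖y - w‖

theorem projOnto_spec {n : ℕ} {K : Set (EuclideanSpace ℝ (Fin n))} (hne : K.Nonempty)
    (hcl : IsClosed K) (hcv : Convex ℝ K) (y : EuclideanSpace ℝ (Fin n)) :
    projOnto K y ∈ K ∧ ∀ w ∈ K, ‖y - projOnto K y‖ ≤ ‖y - w‖ := by
  have h : ∃ z, z ∈ K ∧ ∀ w ∈ K, ‖y - z‖ ≤ ‖y - w‖ := by
    obtain ⟨z, hz, he⟩ := exists_norm_eq_iInf_of_complete_convex hne hcl.isComplete hcv y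
    refine ⟨z, hz, fun w hw => ?_⟩
    rw [he]
    exact ciInf_le (f := fun w : K => ‖y - w‖)
      ⟨0, Set.forall_mem_range.2 fun _ => norm_nonneg _⟩ ⟨w, hw⟩
  exact Classical.epsilon_spec h

theorem eq_projOnto {n : ℕ} {K : Set (EuclideanSpace ℝ (Fin n))}
    (hcl : IsClosed K) (hcv : Convex ℝ K) {y z : EuclideanSpace ℝ (Fin n)} (hz : z ∈ K)
    (hmin : ∀ w ∈ K, ‖y - z‖ ≤ ‖y - w‖) : z = projOnto K y := by
  have hne : K.Nonempty := ⟨z, hz⟩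
  obtain ⟨hp, hpm⟩ := projOnto_spec hne hcl hcv y
  have key : ∀ v ∈ K, (∀ w ∈ K, ‖y - v‖ ≤ ‖y - w‖) → ∀ w ∈ K, inner ℝ (y - v) (w - v) ≤ 0 := by
    intro v hv hvm
    have : Nonempty K := ⟨⟨v, hv⟩⟩
    refine (norm_eq_iInf_iff_real_inner_le_zero hcv hv).1 (le_antisymm ?_ ?_)
    · exact le_ciInf fun w => hvm w w.2
    · exact ciInf_le (f := fun w : K => ‖y - w‖)
        ⟨0, Set.forall_mem_range.2 fun _ => norm_nonneg _⟩ ⟨v, hv⟩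
  have h1 := key z hz hmin _ hp
  have h2 := key _ hp hpm _ hz
  have h3 : inner ℝ (z - projOnto K y) (z - projOnto K y) ≤ (0 : ℝ) := by
    have e : inner ℝ (z - projOnto K y) (z - projOnto K y)
        = inner ℝ (y - z) (projOnto K y - z)
          + (inner ℝ (y - projOnto K y) (z - projOnto K y) : ℝ) := by
      simp only [inner_sub_left, inner_sub_right, real_inner_comm]
      ring
    linarith
  rw [real_inner_self_eq_norm_sq] at h3
  exact sub_eq_zero.1 (norm_eq_zero.1 (by nlinarith [norm_nonneg (z - projOnto K y)]))

/-- The smallest eigenvalue of a real (symmetric) matrix. -/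
def lambdaMin {n : ℕ} (M : Matrix (Fin n) (Fin n) ℝ) : ℝ :=
  sInf {μ : ℝ | Module.End.HasEigenvalue (Matrix.toLin' M) μ}

/-- `Q^{-1/2}`: the inverse of the positive semidefinite square root. -/
def invSqrt {n : ℕ} (Q : Matrix (Fin n) (Fin n) ℝ) : Matrix (Fin n) (Fin n) ℝ :=
  (CFC.sqrt Q)⁻¹

/-- Absolute continuity on the half-open interval `(a, b]`: the restriction to `(a, b]` extends to
an absolutely continuous function on `[a, b]`. -/
def AbsContOnIoc {E : Type*} [NormedAddCommGroup E] (x : ℝ → E) (a b : ℝ) : Prop :=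
  ∃ z : ℝ → E, AbsolutelyContinuousOnInterval z a b ∧ EqOn x z (Ioc a b)

/-- The data of a fractional-order projection neural network with impulses
`ᶜD^α x = -x + P_K(x - ρ A x - ρ b)`, `Δx(t_k) = U_k(x(t_k))` for `k = 1, …, m`.
Only the values `t k` for `k ≤ m` and `U k` for `1 ≤ k ≤ m` matter. -/
structure ImpulsiveProjectionNetwork (n : ℕ) where
  /-- the order of the fractional derivative -/
  α : ℝ
  α_pos : 0 < α
  α_lt_one : α < 1
  /-- the constraint set -/
  K : Set (EuclideanSpace ℝ (Fin n))
  K_nonempty : K.Nonempty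
  K_closed : IsClosed K
  K_convex : Convex ℝ K
  A : Matrix (Fin n) (Fin n) ℝ
  b : EuclideanSpace ℝ (Fin n)
  ρ : ℝ
  /-- the number of impulses -/
  m : ℕ
  /-- the impulse moments `0 = t_0 < t_1 < ⋯ < t_m` -/
  t : ℕ → ℝ
  t_zero : t 0 = 0
  t_lt : ∀ k < m, t k < t (k + 1)
  /-- the jump operators -/
  U : ℕ → EuclideanSpace ℝ (Fin n) → EuclideanSpace ℝ (Fin n)

namespace ImpulsiveProjectionNetwork

variable {n : ℕ}

/-- The projected point `P_K(x - ρ A x - ρ b)`. -/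
def proj (S : ImpulsiveProjectionNetwork n) (x : EuclideanSpace ℝ (Fin n)) :
    EuclideanSpace ℝ (Fin n) :=
  projOnto S.K (x - S.ρ • Matrix.toEuclideanLin S.A x - S.ρ • S.b)

/-- The nodes `t_0 < t_1 < ⋯ < t_m < t_{m+1} = T` for the time interval `[0, T]`. -/
def node (S : ImpulsiveProjectionNetwork n) (T : ℝ) (k : ℕ) : ℝ :=
  if k ≤ S.m then S.t k else T

/-- `x` is a solution of the network on `[0, T]` (where `T > t_m`) with `x(0) = x₀`. -/
structure IsSolution (S : ImpulsiveProjectionNetwork n) (T : ℝ)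
    (x₀ : EuclideanSpace ℝ (Fin n)) (x : ℝ → EuclideanSpace ℝ (Fin n)) : Prop where
  initial : x 0 = x₀
  /-- absolute continuity on `[0, t_1]` -/
  absCont_first : AbsolutelyContinuousOnInterval x 0 (S.node T 1)
  /-- absolute continuity on `(t_k, t_{k+1}]` for `k = 1, …, m` -/
  absCont : ∀ k, 1 ≤ k → k ≤ S.m → AbsContOnIoc x (S.node T k) (S.node T (k + 1))
  /-- the fractional differential equation, almost everywhere -/
  equation : ∀ᵐ s ∂(volume.restrict (Icc 0 T)), caputoDeriv S.α x s = -x s + S.proj (x s)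
  /-- `x(t_k^-) = x(t_k)` -/
  left_limit : ∀ k, 1 ≤ k → k ≤ S.m → Tendsto x (𝓝[<] (S.t k)) (𝓝 (x (S.t k)))
  /-- `x(t_k^+) = x(t_k^-) + U_k(x(t_k))` -/
  jump : ∀ k, 1 ≤ k → k ≤ S.m →
    Tendsto x (𝓝[>] (S.t k)) (𝓝 (x (S.t k) + S.U k (x (S.t k))))

/-- `x*` is an equilibrium point. -/
def IsEquilibrium (S : ImpulsiveProjectionNetwork n) (xstar : EuclideanSpace ℝ (Fin n)) : Prop :=
  -xstar + S.proj xstar = 0 ∧ ∀ k, 1 ≤ k → k ≤ S.m → S.U k xstar = 0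

/-- Global Mittag-Leffler stability of `x*`:
`‖x(t) - x*‖ ≤ [M(x₀ - x*) E_α(-lam t^α)]^p` for all solutions, with `M` nonnegative, locally
Lipschitz and `M(0) = 0`. The constants `lam, p > 0` and the function `M` do not depend on the
initial value, on the solution, or on the length `T > t_m` of the time interval. -/
def IsGloballyMittagLefflerStable (S : ImpulsiveProjectionNetwork n)
    (xstar : EuclideanSpace ℝ (Fin n)) : Prop :=
  ∃ (lam p : ℝ) (M : EuclideanSpace ℝ (Fin n) → ℝ), 0 < lam ∧ 0 < p ∧
    LocallyLipschitz M ∧ M 0 = 0 ∧ (∀ y, 0 ≤ M y) ∧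
    ∀ T : ℝ, S.t S.m < T →
      ∀ (x₀ : EuclideanSpace ℝ (Fin n)) (x : ℝ → EuclideanSpace ℝ (Fin n)),
        S.IsSolution T x₀ x →
        ∀ t ∈ Icc 0 T, ‖x t - xstar‖ ≤ (M (x₀ - xstar) * mittagLeffler S.α (-lam * t ^ S.α)) ^ p

end ImpulsiveProjectionNetwork

end

/-! Put z = Q^{1/2}(x - x*). Nonexpansivity of the projection, Young's inequality with weight ρ₁ and
the eigenvalue condition make the flow dissipative: the inner product of z with its Caputo
derivative is at most -(c/2)‖z‖², where c is the smallest eigenvalue in the hypothesis. The second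
matrix inequality makes every impulse nonexpansive for ‖z‖.

The obstacle is memory. The derivative keeps its lower terminal 0 and ignores the jumps, so ‖z‖² can
be treated as a Lyapunov function only on one piece at a time, with lower terminal t_k. The rest of
the integral, over earlier pieces, is a perturbation. Since the kernel (t-s)^{-α} increases in s, a
second mean value inequality bounds it by D(t-t_k)^{-α}, where D involves only the sizes of z on
those pieces and not of its derivative (`norm_integral_abelKernel_le`,
`ae_norm_abelIntegral_sub_le`). The same mean value inequality yields the fractional Leibniz
inequality for convex functions (`abelIntegral_le_inner`), hence a comparison principle.

Fractional integration turns the perturbation into a constant, so each piece is bounded by a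
multiple of ‖z(0)‖ (`norm_le_of_dissipative`, `norm_le_pow_mul_of_pieces`). For decay, ‖z‖² is
compared with K E_α(-l(t-t_k)^α): half of the dissipation drives the comparison, the other half
absorbs the memory, because E_α(-l s^α) ≥ 1/(1 + lΓ(1-α)s^α) decays no faster than s^{-α}
(`inv_le_mittagLeffler`). This is needed on the last piece only; for t > 2t_m one has t - t_m ≥ t/2,
and for t ≤ 2t_m boundedness suffices. -/

/-- `u` is a primitive on `[a, b]` of the integrable function `w`. -/
def IsPrimitiveOn {E : Type*} [NormedAddCommGroup E] [NormedSpace ℝ E]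
    (w u : ℝ → E) (a b : ℝ) : Prop :=
  IntervalIntegrable w volume a b ∧ ∀ t ∈ Icc a b, u t = u a + ∫ s in a..t, w s

/-- The unnormalised Caputo derivative with lower terminal `a`, as a functional of the
derivative `w`. -/
noncomputable def abelIntegral {E : Type*} [NormedAddCommGroup E] [NormedSpace ℝ E]
    (α : ℝ) (w : ℝ → E) (a t : ℝ) : E :=
  ∫ s in a..t, ((t - s) ^ (-α)) • w s

/-! ### Beta integrals on an arbitrary interval -/

section Beta

theorem integral_rpow_mul_rpow {p q r t : ℝ} (hp : 0 < p) (hq : 0 < q) (hrt : r < t) :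
    ∫ s in r..t, (t - s) ^ (p - 1) * (s - r) ^ (q - 1)
      = (t - r) ^ (p + q - 1) * ProbabilityTheory.beta p q := by
  have h0 : ∫ s in (0 : ℝ)..(t - r), ((t - r) - s) ^ (p - 1) * s ^ (q - 1)
      = (t - r) ^ (p + q - 1) * ProbabilityTheory.beta p q := by
    have hτ : 0 < t - r := sub_pos.2 hrt
    have h := Complex.betaIntegral_scaled (q : ℂ) (p : ℂ) hτ
    have hb : Complex.betaIntegral (q : ℂ) (p : ℂ) = (ProbabilityTheory.beta p q : ℝ) := by
      rw [Complex.betaIntegral_eq_Gamma_mul_div _ _ (by simpa) (by simpa), ProbabilityTheory.beta,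
        ← Complex.ofReal_add, Complex.Gamma_ofReal, Complex.Gamma_ofReal, Complex.Gamma_ofReal]
      push_cast
      rw [add_comm (q : ℝ) p]
      ring
    have hl : ∫ x in (0 : ℝ)..(t - r), (x : ℂ) ^ ((q : ℂ) - 1) * (((t - r : ℝ) : ℂ) - x) ^ ((p : ℂ) - 1)
        = ((∫ s in (0 : ℝ)..(t - r), ((t - r) - s) ^ (p - 1) * s ^ (q - 1) : ℝ) : ℂ) := by
      rw [← intervalIntegral.integral_ofReal]
      refine intervalIntegral.integral_congr fun x hx => ?_
      rw [uIcc_of_le hτ.le] at hx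
      simp only [Complex.ofReal_mul]
      rw [Complex.ofReal_cpow (sub_nonneg.2 hx.2), Complex.ofReal_cpow hx.1]
      push_cast
      ring
    rw [hl, hb] at h
    have hc : (((t - r : ℝ) : ℂ)) ^ ((q : ℂ) + p - 1) = (((t - r) ^ (p + q - 1) : ℝ) : ℂ) := by
      rw [Complex.ofReal_cpow hτ.le]
      push_cast
      ring_nf
    rw [hc] at h
    exact_mod_cast h
  have h1 := intervalIntegral.integral_comp_sub_right (a := r) (b := t)
    (fun s => ((t - r) - s) ^ (p - 1) * s ^ (q - 1)) r
  rw [sub_self] at h1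
  rw [← h0, ← h1]
  simp

theorem intervalIntegrable_rpow_mul_rpow {p q r t : ℝ} (hp : 0 < p) (hq : 0 < q) (hrt : r < t) :
    IntervalIntegrable (fun s => (t - s) ^ (p - 1) * (s - r) ^ (q - 1)) volume r t := by
  apply intervalIntegral.intervalIntegrable_of_integral_ne_zero
  rw [integral_rpow_mul_rpow hp hq hrt]
  exact mul_ne_zero (Real.rpow_pos_of_pos (sub_pos.2 hrt) _).ne'
    (ProbabilityTheory.beta_pos hp hq).ne'

end Beta

/-! ### Second mean value inequalities by layer-cake decomposition -/

section LayerCake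

/-- Fubini applied to k(s) = ∫₀^∞ 1_{v < k(s)} dv; absolute integrability on the product reduces to
that of k f. -/
theorem integral_mul_eq_integral_superlevel {c d : ℝ} {k f : ℝ → ℝ}
    (hk : MonotoneOn k (Ioo c d)) (hk0 : ∀ s ∈ Ioo c d, 0 ≤ k s)
    (hf : IntegrableOn f (Ioo c d)) (hkf : IntegrableOn (fun s => k s * f s) (Ioo c d)) :
    ∫ s in Ioo c d, k s * f s
      = ∫ v in Ioi (0 : ℝ), ∫ s in Ioo c d, (if v < k s then f s else 0) := by
  have hkm : AEMeasurable k (volume.restrict (Ioo c d)) :=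
    aemeasurable_restrict_of_monotoneOn measurableSet_Ioo hk
  set F : ℝ → ℝ → ℝ := fun s v => if v < k s then f s else 0 with hF
  have hmeas : AEStronglyMeasurable (Function.uncurry F)
      ((volume.restrict (Ioo c d)).prod (volume.restrict (Ioi (0 : ℝ)))) := by
    have h1 : AEStronglyMeasurable (fun p : ℝ × ℝ => f p.1)
        ((volume.restrict (Ioo c d)).prod (volume.restrict (Ioi (0 : ℝ)))) :=
      hf.aestronglyMeasurable.comp_fst
    have h2 : NullMeasurableSet {p : ℝ × ℝ | p.2 < k p.1}
        ((volume.restrict (Ioo c d)).prod (volume.restrict (Ioi (0 : ℝ)))) :=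
      nullMeasurableSet_lt (by fun_prop) (hkm.comp_fst)
    have := h1.indicator₀ h2
    refine this.congr (Eventually.of_forall fun p => ?_)
    simp [F, Function.uncurry, indicator]
  have hin : ∀ s ∈ Ioo c d, ∀ y : ℝ, ∫ v in Ioi (0 : ℝ), (if v < k s then y else 0) = k s * y := by
    intro s hs y
    have : ∀ v, (if v < k s then y else 0) = (Iio (k s)).indicator (fun _ => y) v := by
      intro v; simp [indicator]
    simp_rw [this]
    rw [setIntegral_indicator measurableSet_Iio, Ioi_inter_Iio, setIntegral_const]
    simp [hk0 s hs]
  have hint : Integrable (Function.uncurry F)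
      ((volume.restrict (Ioo c d)).prod (volume.restrict (Ioi (0 : ℝ)))) := by
    rw [integrable_prod_iff hmeas]
    constructor
    · refine Eventually.of_forall fun s => ?_
      simp only [Function.uncurry, F]
      have : (fun v => if v < k s then f s else 0) = (Iio (k s)).indicator (fun _ => f s) := by
        ext v; simp [indicator]
      rw [this, integrable_indicator_iff measurableSet_Iio]
      unfold IntegrableOn
      rw [Measure.restrict_restrict measurableSet_Iio, Iio_inter_Ioi]
      simp
    · refine hkf.norm.congr ?_
      filter_upwards [ae_restrict_mem measurableSet_Ioo] with s hs
      have : ∀ v, ‖Function.uncurry F (s, v)‖ = if v < k s then ‖f s‖ else 0 := by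
        intro v
        simp only [Function.uncurry, F]
        split_ifs <;> simp
      simp_rw [this]
      rw [hin s hs, norm_mul, Real.norm_of_nonneg (hk0 s hs)]
  rw [← integral_integral_swap hint]
  refine setIntegral_congr_fun measurableSet_Ioo fun s hs => ?_
  exact (hin s hs (f s)).symm

/-- A superlevel set of an increasing function is a right tail of the interval, up to its left
endpoint, so only tail integrals of `f` occur. -/
theorem superlevel_integral_le {c d N v : ℝ} {k f : ℝ → ℝ} (hN : 0 ≤ N)
    (hk : MonotoneOn k (Ioo c d))
    (htail : ∀ r ∈ Icc c d, ∫ s in r..d, f s ≤ N) :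
    ∫ s in Ioo c d, (if v < k s then f s else 0) ≤ N := by
  by_cases hne : ∃ s ∈ Ioo c d, v < k s
  swap
  · push Not at hne
    rw [setIntegral_congr_fun (g := fun _ => (0 : ℝ)) measurableSet_Ioo]
    · simpa
    · intro s hs
      simp [not_lt.2 (hne s hs)]
  obtain ⟨s₀, hs₀, hv⟩ := hne
  set A : Set ℝ := {s | s ∈ Ioo c d ∧ v < k s} with hA
  have hbdd : BddBelow A := ⟨c, fun s hs => hs.1.1.le⟩
  have hAne : A.Nonempty := ⟨s₀, hs₀, hv⟩
  set r := sInf A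
  have hrc : c ≤ r := le_csInf hAne fun s hs => hs.1.1.le
  have hrd : r ≤ d := (csInf_le hbdd ⟨hs₀, hv⟩).trans hs₀.2.le
  refine le_trans (le_of_eq ?_) (htail r ⟨hrc, hrd⟩)
  rw [intervalIntegral.integral_of_le hrd, integral_Ioc_eq_integral_Ioo,
    ← integral_indicator measurableSet_Ioo, ← integral_indicator measurableSet_Ioo]
  refine integral_congr_ae ?_
  have : ∀ᵐ s : ℝ, s ≠ r := by simp [ae_iff, measure_singleton]
  filter_upwards [this] with s hs
  rcases lt_or_gt_of_ne hs with h | h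
  · have h1 : s ∉ Ioo r d := fun h' => absurd h'.1 (not_lt.2 h.le)
    rw [indicator_of_notMem h1]
    by_cases h2 : s ∈ Ioo c d
    · rw [indicator_of_mem h2, if_neg]
      exact fun hv' => absurd (csInf_le hbdd ⟨h2, hv'⟩) (not_le.2 h)
    · rw [indicator_of_notMem h2]
  · by_cases h2 : s < d
    · have h3 : s ∈ Ioo c d := ⟨hrc.trans_lt h, h2⟩
      rw [indicator_of_mem h3, indicator_of_mem (show s ∈ Ioo r d from ⟨h, h2⟩), if_pos]
      obtain ⟨s', hs', hlt⟩ := exists_lt_of_csInf_lt hAne h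
      exact hs'.2.trans_le (hk hs'.1 h3 hlt.le)
    · rw [indicator_of_notMem (fun h' => h2 h'.2), indicator_of_notMem (fun h' => h2 h'.2)]

/-- A second mean value inequality for the integral against an increasing weight. -/
theorem integral_monotone_mul_nonpos {c d : ℝ} {k f : ℝ → ℝ}
    (hk : MonotoneOn k (Ioo c d)) (hk0 : ∀ s ∈ Ioo c d, 0 ≤ k s)
    (hf : IntegrableOn f (Ioo c d)) (hkf : IntegrableOn (fun s => k s * f s) (Ioo c d))
    (htail : ∀ r ∈ Icc c d, ∫ s in r..d, f s ≤ 0) :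
    ∫ s in Ioo c d, k s * f s ≤ 0 := by
  rw [integral_mul_eq_integral_superlevel hk hk0 hf hkf]
  exact integral_nonpos fun v => superlevel_integral_le le_rfl hk htail

/-- A second mean value inequality for the integral against a bounded increasing weight. -/
theorem integral_monotone_mul_le {c d N C : ℝ} {k f : ℝ → ℝ} (hN : 0 ≤ N) (hC : 0 ≤ C)
    (hk : MonotoneOn k (Ioo c d)) (hk0 : ∀ s ∈ Ioo c d, 0 ≤ k s) (hkC : ∀ s ∈ Ioo c d, k s ≤ C)
    (hf : IntegrableOn f (Ioo c d)) (htail : ∀ r ∈ Icc c d, ∫ s in r..d, f s ≤ N) :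
    ∫ s in Ioo c d, k s * f s ≤ C * N := by
  have hkm : AEMeasurable k (volume.restrict (Ioo c d)) :=
    aemeasurable_restrict_of_monotoneOn measurableSet_Ioo hk
  have hkf : IntegrableOn (fun s => k s * f s) (Ioo c d) := by
    refine Integrable.bdd_mul (c := C) hf hkm.aestronglyMeasurable ?_
    filter_upwards [ae_restrict_mem measurableSet_Ioo] with s hs
    rw [Real.norm_of_nonneg (hk0 s hs)]
    exact hkC s hs
  rw [integral_mul_eq_integral_superlevel hk hk0 hf hkf]
  have h1 : ∀ v, ∫ s in Ioo c d, (if v < k s then f s else 0) ≤ (Iio C).indicator (fun _ => N) v := by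
    intro v
    by_cases hv : v < C
    · rw [indicator_of_mem (show v ∈ Iio C from hv)]
      exact superlevel_integral_le hN hk htail
    · rw [indicator_of_notMem (show v ∉ Iio C from hv),
        setIntegral_congr_fun (g := fun _ => (0 : ℝ)) measurableSet_Ioo]
      · simp
      · intro s hs
        simp [not_lt.2 ((hkC s hs).trans (not_lt.1 hv))]
  have h2 : ∫ v in Ioi (0 : ℝ), (Iio C).indicator (fun _ => N) v = C * N := by
    rw [setIntegral_indicator measurableSet_Iio, Ioi_inter_Iio, setIntegral_const]
    simp [hC]
  rw [← h2]
  -- If the outer function were not integrable, its integral would be 0 by convention, and the bound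
  -- would hold trivially.
  by_cases hi : Integrable (fun v => ∫ s in Ioo c d, (if v < k s then f s else 0))
      (volume.restrict (Ioi (0 : ℝ)))
  · refine integral_mono hi ?_ h1
    rw [integrable_indicator_iff measurableSet_Iio]
    unfold IntegrableOn
    rw [Measure.restrict_restrict measurableSet_Iio, Iio_inter_Ioi]
    simp
  · rw [integral_undef hi, h2]
    positivity

end LayerCake

/-! ### Calculus of absolutely continuous functions as primitives -/

section Primitive

variable {E : Type*} [NormedAddCommGroup E] [NormedSpace ℝ E]

namespace IsPrimitiveOn

variable {w u : ℝ → E} {a b : ℝ}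

theorem intervalIntegrable_of_mem (h : IsPrimitiveOn w u a b) {s t : ℝ} (hs : s ∈ Icc a b)
    (ht : t ∈ Icc a b) : IntervalIntegrable w volume s t :=
  h.1.mono_set (by rw [uIcc_of_le (hs.1.trans hs.2)]; exact uIcc_subset_Icc hs ht)

theorem integral_eq_sub (h : IsPrimitiveOn w u a b) {s t : ℝ} (hs : s ∈ Icc a b)
    (ht : t ∈ Icc a b) : ∫ x in s..t, w x = u t - u s := by
  have ha : a ∈ Icc a b := ⟨le_rfl, hs.1.trans hs.2⟩
  rw [h.2 t ht, h.2 s hs, ← intervalIntegral.integral_add_adjacent_intervals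
    (h.intervalIntegrable_of_mem ha hs) (h.intervalIntegrable_of_mem hs ht)]
  abel

theorem continuousOn (h : IsPrimitiveOn w u a b) : ContinuousOn u (Icc a b) := by
  rcases le_or_gt a b with hab | hab
  · have := intervalIntegral.continuousOn_primitive_interval' h.1 left_mem_uIcc
    rw [uIcc_of_le hab] at this
    exact (continuousOn_const.add this).congr fun t ht => h.2 t ht
  · simp [Icc_eq_empty (not_le.2 hab)]

theorem sub {v y : ℝ → E} (h : IsPrimitiveOn w u a b) (h' : IsPrimitiveOn v y a b) :
    IsPrimitiveOn (fun s => w s - v s) (fun s => u s - y s) a b := by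
  refine ⟨h.1.sub h'.1, fun t ht => ?_⟩
  have ha : a ∈ Icc a b := ⟨le_rfl, ht.1.trans ht.2⟩
  rw [intervalIntegral.integral_sub (h.intervalIntegrable_of_mem ha ht)
    (h'.intervalIntegrable_of_mem ha ht), h.integral_eq_sub ha ht, h'.integral_eq_sub ha ht]
  simp only
  abel

theorem congr_ae {v y : ℝ → E} (hab : a ≤ b) (h : IsPrimitiveOn w u a b)
    (hv : ∀ᵐ t, t ∈ Ioo a b → w t = v t) (hy : ∀ t ∈ Icc a b, u t = y t) :
    IsPrimitiveOn v y a b := by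
  have hb : ∀ᵐ t : ℝ, t ≠ b := by simp [ae_iff, measure_singleton]
  have hv' : ∀ c ∈ Icc a b, w =ᵐ[volume.restrict (uIoc a c)] v := by
    intro c hc
    rw [uIoc_of_le hc.1]
    refine (ae_restrict_iff' measurableSet_Ioc).2 ?_
    filter_upwards [hv, hb] with t h1 h2 h3
    exact h1 ⟨h3.1, lt_of_le_of_ne (h3.2.trans hc.2) h2⟩
  refine ⟨h.1.congr_ae (hv' b ⟨hab, le_rfl⟩), fun t ht => ?_⟩
  rw [← hy t ht, ← hy a ⟨le_rfl, hab⟩, h.2 t ht, intervalIntegral.integral_congr_ae_restrict (hv' t ht)]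

theorem clm_apply {F : Type*} [NormedAddCommGroup F] [NormedSpace ℝ F] [CompleteSpace E]
    [CompleteSpace F] (h : IsPrimitiveOn w u a b) (T : E →L[ℝ] F) :
    IsPrimitiveOn (fun s => T (w s)) (fun s => T (u s)) a b := by
  refine ⟨⟨T.integrable_comp h.1.1, T.integrable_comp h.1.2⟩, fun t ht => ?_⟩
  have ha : a ∈ Icc a b := ⟨le_rfl, ht.1.trans ht.2⟩
  rw [T.intervalIntegral_comp_comm (h.intervalIntegrable_of_mem ha ht), ← map_add, ← h.2 t ht]

end IsPrimitiveOn

theorem AbsolutelyContinuousOnInterval.isPrimitiveOn {f : ℝ → ℝ} {a b : ℝ}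
    (hf : AbsolutelyContinuousOnInterval f a b) : IsPrimitiveOn (deriv f) f a b := by
  refine ⟨hf.intervalIntegrable_deriv, fun t ht => ?_⟩
  rw [(hf.mono (d := t) (c := a) ?_).integral_deriv_eq_sub]
  · ring
  · rw [uIcc_of_le ht.1, uIcc_of_le (ht.1.trans ht.2)]
    exact Icc_subset_Icc_right ht.2

theorem IsPrimitiveOn.ae_hasDerivAt [CompleteSpace E] {w u : ℝ → E} {a b : ℝ}
    (h : IsPrimitiveOn w u a b) : ∀ᵐ t, t ∈ Ioo a b → HasDerivAt u (w t) t := by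
  filter_upwards [h.1.ae_hasDerivAt_integral] with t ht htab
  have hle : a ≤ b := (htab.1.trans htab.2).le
  have h1 := (ht (by rw [uIcc_of_le hle]; exact Ioo_subset_Icc_self htab) a left_mem_uIcc).const_add (u a)
  refine h1.congr_of_eventuallyEq ?_
  filter_upwards [Ioo_mem_nhds htab.1 htab.2] with s hs
  exact h.2 s (Ioo_subset_Icc_self hs)

/-- Chain rule for absolutely continuous functions. -/
theorem IsPrimitiveOn.of_lipschitz [CompleteSpace E] {w u : ℝ → E} {a b : ℝ} (hab : a ≤ b)
    (h : IsPrimitiveOn w u a b) {f g : ℝ → ℝ} {C : ℝ}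
    (hLip : ∀ s ∈ Icc a b, ∀ t ∈ Icc a b, |f s - f t| ≤ C * ‖u s - u t‖)
    (hder : ∀ t ∈ Ioo a b, HasDerivAt u (w t) t → HasDerivAt f (g t) t) :
    IsPrimitiveOn g f a b := by
  have hAC : AbsolutelyContinuousOnInterval f a b := by
    -- Increments of `f` are dominated by |C| times those of t ↦ ∫ₐᵗ ‖w‖, which is absolutely
    -- continuous.
    have hW := (h.1.norm.absolutelyContinuousOnInterval_intervalIntegral
      (c := a) left_mem_uIcc).const_mul |C|
    rw [absolutelyContinuousOnInterval_iff] at hW ⊢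
    intro ε hε
    obtain ⟨δ, hδ, H⟩ := hW ε hε
    refine ⟨δ, hδ, fun I hI hlt => lt_of_le_of_lt (Finset.sum_le_sum fun i hi => ?_) (H I hI hlt)⟩
    have hmem := hI.1 i hi
    rw [uIcc_of_le hab] at hmem
    obtain ⟨hs, ht⟩ := hmem
    have ha : a ∈ Icc a b := ⟨le_rfl, hab⟩
    rw [Real.dist_eq, Real.dist_eq, ← mul_sub, abs_mul, abs_abs]
    refine (hLip _ hs _ ht).trans ?_
    gcongr
    · exact le_abs_self C
    · rw [intervalIntegral.integral_interval_sub_left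
        (h.intervalIntegrable_of_mem ha hs).norm (h.intervalIntegrable_of_mem ha ht).norm,
        ← h.integral_eq_sub ht hs]
      exact intervalIntegral.norm_integral_le_abs_integral_norm
  refine hAC.isPrimitiveOn.congr_ae hab ?_ fun _ _ => rfl
  filter_upwards [h.ae_hasDerivAt] with t ht htab
  exact (hder t htab (ht htab)).deriv

theorem IsPrimitiveOn.norm_sq {E : Type*} [NormedAddCommGroup E] [InnerProductSpace ℝ E]
    [CompleteSpace E] {w u : ℝ → E} {a b : ℝ} (hab : a ≤ b)
    (h : IsPrimitiveOn w u a b) :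
    IsPrimitiveOn (fun s => 2 * inner ℝ (u s) (w s)) (fun s => ‖u s‖ ^ 2) a b := by
  obtain ⟨C, hC⟩ := isCompact_Icc.exists_bound_of_continuousOn h.continuousOn
  refine h.of_lipschitz hab (C := 2 * C) (fun s hs t ht => ?_) fun t _ ht => ht.norm_sq
  have h1 : |‖u s‖ - ‖u t‖| ≤ ‖u s - u t‖ := abs_norm_sub_norm_le _ _
  have h2 : ‖u s‖ ^ 2 - ‖u t‖ ^ 2 = (‖u s‖ + ‖u t‖) * (‖u s‖ - ‖u t‖) := by ring
  rw [h2, abs_mul, abs_of_nonneg (by positivity)]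
  have := hC s hs
  have := hC t ht
  exact mul_le_mul (by linarith) h1 (abs_nonneg _) (by linarith [norm_nonneg (u s)])

/-- The squared positive part is C¹ and convex, with first-order remainder at most (y - x)². It
replaces the nonsmooth positive part in the comparison principle. -/
theorem hasDerivAt_max_zero_sq (x : ℝ) : HasDerivAt (fun y : ℝ => max y 0 ^ 2) (2 * max x 0) x := by
  rw [hasDerivAt_iff_isLittleO]
  have hO : (fun y : ℝ => max y 0 ^ 2 - max x 0 ^ 2 - (y - x) • (2 * max x 0))
      =O[𝓝 x] fun y => (y - x) ^ 2 := by
    refine Asymptotics.IsBigO.of_bound 1 (Eventually.of_forall fun y => ?_)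
    rw [Real.norm_eq_abs, Real.norm_eq_abs, abs_of_nonneg (sq_nonneg (y - x)), smul_eq_mul, abs_le]
    rcases max_cases x 0 with ⟨h1, h2⟩ | ⟨h1, h2⟩ <;> rcases max_cases y 0 with ⟨h3, h4⟩ | ⟨h3, h4⟩ <;>
      rw [h1, h3] <;> constructor <;> nlinarith
  refine hO.trans_isLittleO ?_
  have h1 : Tendsto (fun y : ℝ => y - x) (𝓝 x) (𝓝 0) := by
    have : Tendsto (fun y : ℝ => y - x) (𝓝 x) (𝓝 (x - x)) := (continuous_id.sub continuous_const).tendsto x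
    simpa using this
  have := (Asymptotics.isLittleO_pow_id (one_lt_two)).comp_tendsto (k := fun y : ℝ => y - x) h1
  simpa [Function.comp_def] using this

theorem IsPrimitiveOn.max_zero_sq {w u : ℝ → ℝ} {a b : ℝ} (hab : a ≤ b)
    (h : IsPrimitiveOn w u a b) :
    IsPrimitiveOn (fun s => 2 * max (u s) 0 * w s) (fun s => max (u s) 0 ^ 2) a b := by
  obtain ⟨C, hC⟩ := isCompact_Icc.exists_bound_of_continuousOn h.continuousOn
  refine h.of_lipschitz hab (C := 2 * C) (fun s hs t ht => ?_) fun t _ ht =>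
    (hasDerivAt_max_zero_sq (u t)).comp t ht
  have h1 : |max (u s) 0 - max (u t) 0| ≤ ‖u s - u t‖ := by
    simpa using abs_max_sub_max_le_abs (u s) (u t) 0
  have h2 : max (u s) 0 ^ 2 - max (u t) 0 ^ 2
    = (max (u s) 0 + max (u t) 0) * (max (u s) 0 - max (u t) 0) := by ring
  rw [h2, abs_mul, abs_of_nonneg (by positivity)]
  have h3 : max (u s) 0 ≤ C := max_le ((le_abs_self _).trans (hC s hs)) ((norm_nonneg _).trans (hC s hs))
  have h4 : max (u t) 0 ≤ C := max_le ((le_abs_self _).trans (hC t ht)) ((norm_nonneg _).trans (hC t ht))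
  exact mul_le_mul (by linarith) h1 (abs_nonneg _) (by linarith [le_max_right (u s) 0])

end Primitive

/-! ### Abel integrals: convergence, fractional Leibniz inequality, memory bound -/

section Abel

variable {E : Type*} [NormedAddCommGroup E] [NormedSpace ℝ E]

/-- A convolution of two L¹ functions converges almost everywhere. This is why the fractional
inequalities derived from it are asserted only for almost every t. -/
theorem ae_intervalIntegrable_abel {α a b : ℝ} (hα : α < 1) (hab : a ≤ b) {w : ℝ → E}
    (hw : IntervalIntegrable w volume a b) :
    ∀ᵐ t, t ∈ Ioo a b → IntervalIntegrable (fun s => ((t - s) ^ (-α)) • w s) volume a t := by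
  have hf : Integrable ((Ioc a b).indicator w) :=
    (integrable_indicator_iff measurableSet_Ioc).2
      ((intervalIntegrable_iff_integrableOn_Ioc_of_le hab).1 hw)
  have hg : Integrable ((Ioc 0 (b - a)).indicator fun x : ℝ => x ^ (-α)) := by
    refine (integrable_indicator_iff measurableSet_Ioc).2
      ((intervalIntegrable_iff_integrableOn_Ioc_of_le (sub_nonneg.2 hab)).1 ?_)
    exact intervalIntegral.intervalIntegrable_rpow' (by linarith)
  filter_upwards [hf.ae_convolution_exists (ContinuousLinearMap.lsmul ℝ ℝ).flip hg] with t ht htab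
  rw [intervalIntegrable_iff_integrableOn_Ioo_of_le htab.1.le]
  refine (Integrable.integrableOn (s := Ioo a t) ht).congr_fun (fun s hs => ?_) measurableSet_Ioo
  have h1 : s ∈ Ioc a b := ⟨hs.1, (hs.2.trans htab.2).le⟩
  have h2 : t - s ∈ Ioc 0 (b - a) := ⟨sub_pos.2 hs.2, by linarith [hs.1, htab.2]⟩
  simp [indicator_of_mem h1, indicator_of_mem h2]

theorem monotoneOn_abelKernel {α c d t : ℝ} (hα : 0 ≤ α) (hdt : d ≤ t) :
    MonotoneOn (fun s => (t - s) ^ (-α)) (Ioo c d) := by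
  intro x hx y hy hxy
  exact Real.rpow_le_rpow_of_nonpos (by linarith [hy.2]) (by linarith) (by linarith)

/-- The fractional Leibniz inequality: for `V` a convex function of `u` with gradient `G`, the
fractional derivative of `V` is bounded by the gradient applied to that of `u`. -/
theorem abelIntegral_le_inner {E : Type*} [NormedAddCommGroup E] [InnerProductSpace ℝ E]
    [CompleteSpace E] {α a b : ℝ} (hα₀ : 0 ≤ α) (hα : α < 1) (hab : a ≤ b) {w u G : ℝ → E}
    {v V : ℝ → ℝ} (hu : IsPrimitiveOn w u a b) (hV : IsPrimitiveOn v V a b)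
    (hconv : ∀ s ∈ Icc a b, ∀ t ∈ Icc a b, V t + inner ℝ (G t) (u s - u t) ≤ V s) :
    ∀ᵐ t, t ∈ Ioo a b → abelIntegral α v a t ≤ inner ℝ (G t) (abelIntegral α w a t) := by
  filter_upwards [ae_intervalIntegrable_abel hα hab hu.1, ae_intervalIntegrable_abel hα hab hV.1]
    with t h1 h2 ht
  replace h1 := h1 ht
  replace h2 := h2 ht
  have ha : a ∈ Icc a b := ⟨le_rfl, hab⟩
  have htI : t ∈ Icc a b := Ioo_subset_Icc_self ht
  have h3 : IntervalIntegrable (fun s => (t - s) ^ (-α) * inner ℝ (G t) (w s)) volume a t := by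
    have := (innerSL ℝ (G t)).integrable_comp h1.1
    have h' := (innerSL ℝ (G t)).integrable_comp h1.2
    refine IntervalIntegrable.congr (f := fun s => innerSL ℝ (G t) ((t - s) ^ (-α) • w s)) (fun s _ => ?_) ⟨this, h'⟩
    simp
  have h4 : inner ℝ (G t) (abelIntegral α w a t)
      = ∫ s in a..t, (t - s) ^ (-α) * inner ℝ (G t) (w s) := by
    have := (innerSL ℝ (G t)).intervalIntegral_comp_comm h1
    simp only [innerSL_apply_apply, inner_smul_right] at this
    rw [abelIntegral, this]
  have hint : ∀ r ∈ Icc a t, IntervalIntegrable (fun s => v s - inner ℝ (G t) (w s)) volume r t := by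
    intro r hr
    have hr' : r ∈ Icc a b := ⟨hr.1, hr.2.trans htI.2⟩
    have hi := hu.intervalIntegrable_of_mem hr' htI
    exact (hV.intervalIntegrable_of_mem hr' htI).sub
      ⟨(innerSL ℝ (G t)).integrable_comp hi.1, (innerSL ℝ (G t)).integrable_comp hi.2⟩
  -- The integral of v - ⟨G(t), w⟩ over [r, t] is minus the convexity gap V(r) - V(t) - ⟨G(t), u(r)
  -- - u(t)⟩, hence nonpositive. No integration by parts at the singularity s = t is needed.
  have key : ∫ s in Ioo a t, (t - s) ^ (-α) * (v s - inner ℝ (G t) (w s)) ≤ 0 := by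
    refine integral_monotone_mul_nonpos (monotoneOn_abelKernel hα₀ le_rfl)
      (fun s hs => Real.rpow_nonneg (sub_nonneg.2 hs.2.le) _) ?_ ?_ fun r hr => ?_
    · exact (intervalIntegrable_iff_integrableOn_Ioo_of_le ht.1.le).1 (hint a ⟨le_rfl, ht.1.le⟩)
    · have := (intervalIntegrable_iff_integrableOn_Ioo_of_le ht.1.le).1 (h2.sub h3)
      refine this.congr_fun (fun s _ => ?_) measurableSet_Ioo
      simp [mul_sub]
    · have hr' : r ∈ Icc a b := ⟨hr.1, hr.2.trans htI.2⟩
      have hi := hu.intervalIntegrable_of_mem hr' htI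
      have e : ∫ s in r..t, inner ℝ (G t) (w s) = inner ℝ (G t) (u t - u r) := by
        have := (innerSL ℝ (G t)).intervalIntegral_comp_comm hi
        simp only [innerSL_apply_apply] at this
        rw [this, hu.integral_eq_sub hr' htI]
      have hi' : IntervalIntegrable (fun s => inner ℝ (G t) (w s)) volume r t :=
        ⟨(innerSL ℝ (G t)).integrable_comp hi.1, (innerSL ℝ (G t)).integrable_comp hi.2⟩
      rw [intervalIntegral.integral_sub (hV.intervalIntegrable_of_mem hr' htI) hi', e,
        hV.integral_eq_sub hr' htI]
      have := hconv r hr' t htI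
      rw [← neg_sub (u t), inner_neg_right] at this
      linarith
  rw [h4, ← sub_nonpos, abelIntegral, ← intervalIntegral.integral_sub h2 h3,
    intervalIntegral.integral_of_le ht.1.le, integral_Ioc_eq_integral_Ioo]
  refine le_trans (le_of_eq ?_) key
  refine setIntegral_congr_fun measurableSet_Ioo fun s _ => ?_
  simp [mul_sub]

/-- Contribution of the past: the Abel integral over `[c, d]` seen from a later time `t`. -/
theorem norm_integral_abelKernel_le {E : Type*} [NormedAddCommGroup E] [InnerProductSpace ℝ E]
    [CompleteSpace E] {α c d t N : ℝ} (hα₀ : 0 ≤ α) (hcd : c ≤ d) (hdt : d < t) {w u : ℝ → E}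
    (hu : IsPrimitiveOn w u c d) (hN : ∀ r ∈ Icc c d, ‖u d - u r‖ ≤ N) :
    ‖∫ s in c..d, ((t - s) ^ (-α)) • w s‖ ≤ (t - d) ^ (-α) * N := by
  set X := ∫ s in c..d, ((t - s) ^ (-α)) • w s with hX
  have hN0 : 0 ≤ N := (norm_nonneg _).trans (hN d ⟨hcd, le_rfl⟩)
  have hi : IntervalIntegrable (fun s => ((t - s) ^ (-α)) • w s) volume c d := by
    refine hu.1.continuousOn_smul ?_
    refine ContinuousOn.rpow_const (by fun_prop) fun s hs => Or.inl ?_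
    rw [uIcc_of_le hcd] at hs
    linarith [hs.2]
  -- The vector estimate becomes scalar by pairing the integral X with itself: tail integrals of ⟨X,
  -- w⟩ are ⟨X, u(d) - u(r)⟩ ≤ ‖X‖ N, and the weight is at most (t - d)^{-α}.
  have h1 : ‖X‖ ^ 2 ≤ (t - d) ^ (-α) * (‖X‖ * N) := by
    rw [← real_inner_self_eq_norm_sq]
    have h2 := (innerSL ℝ X).intervalIntegral_comp_comm hi
    simp only [innerSL_apply_apply, inner_smul_right] at h2
    nth_rewrite 2 [hX]
    rw [← h2, intervalIntegral.integral_of_le hcd, integral_Ioc_eq_integral_Ioo]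
    have hwi : ∀ r ∈ Icc c d, IntervalIntegrable (fun s => inner ℝ X (w s)) volume r d := by
      intro r hr
      have hi := hu.intervalIntegrable_of_mem hr ⟨hcd, le_rfl⟩
      exact ⟨(innerSL ℝ X).integrable_comp hi.1, (innerSL ℝ X).integrable_comp hi.2⟩
    refine integral_monotone_mul_le (by positivity) (Real.rpow_nonneg (by linarith) _)
      (monotoneOn_abelKernel hα₀ hdt.le) (fun s hs => Real.rpow_nonneg (by linarith [hs.2]) _)
      (fun s hs => ?_) ?_ fun r hr => ?_
    · exact Real.rpow_le_rpow_of_nonpos (by linarith) (by linarith [hs.2]) (by linarith)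
    · exact (intervalIntegrable_iff_integrableOn_Ioo_of_le hcd).1 (hwi c ⟨le_rfl, hcd⟩)
    · have := (innerSL ℝ X).intervalIntegral_comp_comm (hu.intervalIntegrable_of_mem hr ⟨hcd, le_rfl⟩)
      simp only [innerSL_apply_apply] at this
      rw [this, hu.integral_eq_sub hr ⟨hcd, le_rfl⟩]
      exact (real_inner_le_norm _ _).trans (by gcongr; exact hN r hr)
  rcases (norm_nonneg X).eq_or_lt with h0 | h0
  · rw [← h0]
    exact mul_nonneg (Real.rpow_nonneg (by linarith) _) hN0
  · refine le_of_mul_le_mul_left ?_ h0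
    nlinarith

end Abel

/-! ### Fractional integration and the comparison principle -/

section Comparison

/-- Fractional integration of a bound on the Caputo derivative. -/
theorem le_add_of_abelIntegral_le {α a b c : ℝ} (hα₀ : 0 < α) (hα : α < 1) {v V : ℝ → ℝ}
    (hV : IsPrimitiveOn v V a b)
    (h : ∀ᵐ s, s ∈ Ioo a b → abelIntegral α v a s ≤ c * (s - a) ^ (-α)) (hc : 0 ≤ c) :
    ∀ t ∈ Icc a b, V t ≤ V a + c := by
  intro t ht
  rcases ht.1.eq_or_lt with rfl | hat
  · linarith
  have hab : a ≤ b := ht.1.trans ht.2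
  have haI : a ∈ Icc a b := ⟨le_rfl, hab⟩
  have hα' : 0 < 1 - α := sub_pos.2 hα
  set B := ProbabilityTheory.beta α (1 - α) with hB
  have hBpos : 0 < B := ProbabilityTheory.beta_pos hα₀ hα'
  have hker : ∀ r, r < t → ∫ s in Ioo r t, (t - s) ^ (α - 1) * (s - r) ^ (-α) = B := by
    intro r hr
    have := integral_rpow_mul_rpow hα₀ hα' hr
    rw [intervalIntegral.integral_of_le hr.le, integral_Ioc_eq_integral_Ioo] at this
    simpa using this
  have hkeri : ∀ r, r < t → IntegrableOn (fun s => (t - s) ^ (α - 1) * (s - r) ^ (-α)) (Ioo r t) := by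
    intro r hr
    have := intervalIntegrable_rpow_mul_rpow hα₀ hα' hr
    simpa using (intervalIntegrable_iff_integrableOn_Ioo_of_le hr.le).1 this
  set μ := (volume : Measure ℝ).restrict (Ioo a t) with hμ
  -- Kernel of the Riemann–Liouville integral composed with the Abel integral, on the triangle r < s
  -- < t. Its integral in s is the constant B = B(α, 1-α), so Fubini recovers B (V(t) - V(a)). The
  -- bound c(s-a)^{-α} integrates to cB by the same formula.
  set k : ℝ → ℝ → ℝ := fun s r => if r < s then (t - s) ^ (α - 1) * (s - r) ^ (-α) else 0 with hk
  have hk0 : ∀ s ∈ Ioo a t, ∀ r, 0 ≤ k s r := by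
    intro s hs r
    simp only [k]
    split_ifs with hrs
    · exact mul_nonneg (Real.rpow_nonneg (by linarith [hs.2]) _) (Real.rpow_nonneg (by linarith) _)
    · exact le_rfl
  have hvi : IntegrableOn v (Ioo a t) := (intervalIntegrable_iff_integrableOn_Ioo_of_le hat.le).1
    (hV.intervalIntegrable_of_mem haI ht)
  have hkind : ∀ r, (fun s => k s r)
      = (Ioi r).indicator fun s => (t - s) ^ (α - 1) * (s - r) ^ (-α) := by
    intro r; ext s; simp [k, indicator]
  have hksi : ∀ r ∈ Ioo a t, Integrable (fun s => k s r) μ := by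
    intro r hr
    rw [hkind, integrable_indicator_iff measurableSet_Ioi]
    unfold IntegrableOn
    rw [hμ, Measure.restrict_restrict measurableSet_Ioi, inter_comm, Ioo_inter_Ioi,
      max_eq_right hr.1.le]
    exact hkeri r hr.2
  have hks : ∀ r ∈ Ioo a t, ∫ s, k s r ∂μ = B := by
    intro r hr
    rw [hkind, hμ, setIntegral_indicator measurableSet_Ioi, Ioo_inter_Ioi, max_eq_right hr.1.le]
    exact hker r hr.2
  have hmeas : AEStronglyMeasurable (Function.uncurry fun s r => k s r * v r) (μ.prod μ) := by
    refine AEStronglyMeasurable.mul (f := fun p : ℝ × ℝ => k p.1 p.2) (g := fun p : ℝ × ℝ => v p.2) ?_ hvi.aestronglyMeasurable.comp_snd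
    refine Measurable.aestronglyMeasurable ?_
    refine Measurable.ite (measurableSet_lt measurable_snd measurable_fst) ?_ measurable_const
    exact ((measurable_const.sub measurable_fst).pow_const _).mul
      ((measurable_fst.sub measurable_snd).pow_const _)
  have hint : Integrable (Function.uncurry fun s r => k s r * v r) (μ.prod μ) := by
    rw [integrable_prod_iff' hmeas]
    constructor
    · filter_upwards [ae_restrict_mem measurableSet_Ioo] with r hr
      simpa only [Function.uncurry] using (hksi r hr).mul_const (v r)
    · refine (hvi.norm.const_mul B).congr ?_
      filter_upwards [ae_restrict_mem measurableSet_Ioo] with r hr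
      rw [← hks r hr, ← integral_mul_const]
      refine setIntegral_congr_fun measurableSet_Ioo fun s hs => ?_
      simp only [Function.uncurry, norm_mul, Real.norm_of_nonneg (hk0 s hs r)]
  have hswap := integral_integral_swap hint
  have hright : ∫ r, ∫ s, k s r * v r ∂μ ∂μ = B * (V t - V a) := by
    rw [← hV.integral_eq_sub haI ht, intervalIntegral.integral_of_le hat.le,
      integral_Ioc_eq_integral_Ioo, ← integral_const_mul]
    refine setIntegral_congr_fun measurableSet_Ioo fun r hr => ?_
    rw [integral_mul_const, hks r hr]
  have hinner : ∀ s ∈ Ioo a t, ∫ r, k s r * v r ∂μ = (t - s) ^ (α - 1) * abelIntegral α v a s := by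
    intro s hs
    have : (fun r => k s r * v r)
        = (Iio s).indicator fun r => (t - s) ^ (α - 1) * ((s - r) ^ (-α) * v r) := by
      ext r
      simp only [k, indicator, mem_Iio]
      split_ifs <;> ring
    rw [this, hμ, setIntegral_indicator measurableSet_Iio, Ioo_inter_Iio, min_eq_right hs.2.le,
      integral_const_mul, abelIntegral, intervalIntegral.integral_of_le hs.1.le,
      integral_Ioc_eq_integral_Ioo]
    simp
  have hle : ∫ s, ∫ r, k s r * v r ∂μ ∂μ ≤ c * B := by
    rw [← hker a hat, ← integral_const_mul]
    refine integral_mono_ae hint.integral_prod_left ((hkeri a hat).const_mul c) ?_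
    filter_upwards [ae_restrict_mem measurableSet_Ioo, ae_restrict_of_ae h] with s hs h1
    refine (hinner s hs).trans_le ?_
    have h2 := h1 ⟨hs.1, hs.2.trans_le ht.2⟩
    calc (t - s) ^ (α - 1) * abelIntegral α v a s
        ≤ (t - s) ^ (α - 1) * (c * (s - a) ^ (-α)) :=
          mul_le_mul_of_nonneg_left h2 (Real.rpow_nonneg (by linarith [hs.2]) _)
      _ = _ := by ring
  rw [hswap, hright] at hle
  have : V t - V a ≤ c := le_of_mul_le_mul_left (by linarith) hBpos
  linarith

/-- Comparison principle: a function which starts nonpositive and whose Caputo derivative is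
nonpositive wherever it is positive remains nonpositive. -/
theorem nonpos_of_abelIntegral_nonpos {α a b : ℝ} (hα₀ : 0 < α) (hα : α < 1) {w u : ℝ → ℝ}
    (hu : IsPrimitiveOn w u a b) (hua : u a ≤ 0)
    (h : ∀ᵐ t, t ∈ Ioo a b → 0 < u t → abelIntegral α w a t ≤ 0) :
    ∀ t ∈ Icc a b, u t ≤ 0 := by
  intro t ht
  have hab : a ≤ b := ht.1.trans ht.2
  -- The gradient 2 max(u, 0) vanishes where u ≤ 0, so by the Leibniz inequality the Abel integral
  -- for max(u, 0)² is nonpositive almost everywhere, with no assumption where u ≤ 0.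
  have hV := hu.max_zero_sq hab
  have hconv := abelIntegral_le_inner (G := fun t => 2 * max (u t) 0) hα₀.le hα hab hu hV (by
    intro s _ t _
    simp only [RCLike.inner_apply, conj_trivial]
    rcases max_cases (u s) 0 with ⟨h1, h2⟩ | ⟨h1, h2⟩ <;>
      rcases max_cases (u t) 0 with ⟨h3, h4⟩ | ⟨h3, h4⟩ <;> rw [h1, h3] <;>
      nlinarith [sq_nonneg (u s - u t)])
  have h0 := le_add_of_abelIntegral_le (c := 0) hα₀ hα hV (by
    filter_upwards [h, hconv] with s h1 h2 hs
    refine (h2 hs).trans ?_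
    simp only [RCLike.inner_apply, conj_trivial, zero_mul]
    rcases max_cases (u s) 0 with ⟨h3, h4⟩ | ⟨h3, h4⟩
    · rcases h4.eq_or_lt with h5 | h5
      · rw [h3, ← h5]; simp
      · rw [h3]
        have := h1 hs h5
        nlinarith
    · rw [h3]; simp) le_rfl t ht
  simp only [max_eq_right hua, add_zero] at h0
  have : max (u t) 0 = 0 := by
    have h1 : max (u t) 0 ^ 2 = 0 := le_antisymm (by simpa using h0) (sq_nonneg _)
    exact pow_eq_zero_iff (two_ne_zero) |>.1 h1
  exact max_eq_right_iff.1 this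

end Comparison

/-! ### The Mittag-Leffler series and its Caputo derivative -/

section MittagLeffler

/-- On (R, ∞) the Gamma integrand is at least R^y e^{-x}. As R is free, Γ(αk + 1) outgrows every
geometric sequence. -/
theorem rpow_mul_exp_neg_le_Gamma {R y : ℝ} (hR : 0 < R) (hy : 0 ≤ y) :
    R ^ y * Real.exp (-R) ≤ Real.Gamma (y + 1) := by
  rw [Real.Gamma_eq_integral (by linarith)]
  have hi : IntegrableOn (fun x : ℝ => Real.exp (-x) * x ^ (y + 1 - 1)) (Ioi 0) :=
    Real.GammaIntegral_convergent (by linarith)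
  have h1 : ∫ x in Ioi R, R ^ y * Real.exp (-x) = R ^ y * Real.exp (-R) := by
    rw [integral_const_mul, integral_exp_neg_Ioi]
  rw [← h1]
  refine le_trans ?_ (setIntegral_mono_set hi ?_ (Ioi_subset_Ioi hR.le).eventuallyLE)
  · refine setIntegral_mono_on ((integrableOn_exp_neg_Ioi R).const_mul _) (hi.mono_set (Ioi_subset_Ioi hR.le))
      measurableSet_Ioi fun x hx => ?_
    rw [mul_comm, add_sub_cancel_right]
    exact mul_le_mul_of_nonneg_left (Real.rpow_le_rpow hR.le (le_of_lt hx) hy) (Real.exp_pos _).le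
  · filter_upwards [ae_restrict_mem measurableSet_Ioi] with x hx
    exact mul_nonneg (Real.exp_pos _).le (Real.rpow_nonneg (le_of_lt hx) _)

theorem summable_mittagLeffler {α : ℝ} (hα : 0 < α) (x : ℝ) :
    Summable fun k : ℕ => x ^ k / Real.Gamma (α * k + 1) := by
  -- Chosen so that R^α = 2|x| + 1, which bounds the series by a geometric one of ratio 1/2.
  set R : ℝ := (2 * |x| + 1) ^ α⁻¹ with hR
  have hRpos : 0 < R := Real.rpow_pos_of_pos (by positivity) _
  have hRα : R ^ α = 2 * |x| + 1 := by
    rw [hR, ← Real.rpow_mul (by positivity), inv_mul_cancel₀ hα.ne', Real.rpow_one]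
  refine Summable.of_norm_bounded (g := fun k : ℕ => Real.exp R * (1 / 2) ^ k)
    ((summable_geometric_of_lt_one (by norm_num) (by norm_num)).mul_left _) fun k => ?_
  have hG := rpow_mul_exp_neg_le_Gamma hRpos (y := α * k) (by positivity)
  rw [Real.rpow_mul hRpos.le, hRα, Real.rpow_natCast] at hG
  have hpos : 0 < (2 * |x| + 1) ^ k * Real.exp (-R) := by positivity
  rw [norm_div, norm_pow, Real.norm_eq_abs, Real.norm_of_nonneg (hpos.le.trans hG)]
  calc |x| ^ k / Real.Gamma (α * k + 1) ≤ |x| ^ k / ((2 * |x| + 1) ^ k * Real.exp (-R)) := by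
        gcongr
    _ = Real.exp R * (|x| / (2 * |x| + 1)) ^ k := by
        rw [Real.exp_neg, div_pow]; field_simp
    _ ≤ Real.exp R * (1 / 2) ^ k := by
        refine mul_le_mul_of_nonneg_left (pow_le_pow_left₀ (by positivity) ?_ k) (Real.exp_pos _).le
        rw [div_le_div_iff₀ (by positivity) (by norm_num)]
        linarith

/-- The `k`-th term of the derivative of `t ↦ E_α(-l t^α)`. -/
noncomputable def mittagLefflerTerm (α l : ℝ) (k : ℕ) (t : ℝ) : ℝ :=
  (-l) ^ (k + 1) / Real.Gamma (α * (k + 1)) * t ^ (α * (k + 1) - 1)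

/-- The derivative of `t ↦ E_α(-l t^α)`. -/
noncomputable def mittagLefflerDensity (α l t : ℝ) : ℝ := ∑' k : ℕ, mittagLefflerTerm α l k t

theorem neg_mul_rpow_pow {α l t : ℝ} (ht : 0 ≤ t) (k : ℕ) :
    (-l * t ^ α) ^ k = (-l) ^ k * t ^ (α * k) := by
  rw [mul_pow, Real.rpow_mul ht, Real.rpow_natCast]

theorem integral_mul_mittagLefflerTerm {α q l t : ℝ} (hα : 0 < α) (hq : 0 < q) (ht : 0 < t) (k : ℕ) :
    IntervalIntegrable (fun s => (t - s) ^ (q - 1) * mittagLefflerTerm α l k s) volume 0 t ∧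
    ∫ s in (0 : ℝ)..t, (t - s) ^ (q - 1) * mittagLefflerTerm α l k s
      = Real.Gamma q * t ^ (q - 1 + α) * (-l) * ((-l * t ^ α) ^ k / Real.Gamma (α * k + α + q)) := by
  have hk : 0 < α * ((k : ℝ) + 1) := by positivity
  have e : (fun s => (t - s) ^ (q - 1) * mittagLefflerTerm α l k s)
      = fun s => (-l) ^ (k + 1) / Real.Gamma (α * (k + 1)) *
          ((t - s) ^ (q - 1) * (s - 0) ^ (α * (k + 1) - 1)) := by
    ext s; rw [mittagLefflerTerm, sub_zero]; ring
  rw [e]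
  refine ⟨(intervalIntegrable_rpow_mul_rpow hq hk ht).const_mul _, ?_⟩
  rw [intervalIntegral.integral_const_mul, integral_rpow_mul_rpow hq hk ht, ProbabilityTheory.beta,
    sub_zero, neg_mul_rpow_pow ht.le, show q + α * ((k : ℝ) + 1) - 1 = (q - 1 + α) + α * k by ring,
    Real.rpow_add ht, show q + α * ((k : ℝ) + 1) = α * k + α + q by ring]
  have := (Real.Gamma_pos_of_pos hk).ne'
  field_simp
  ring

theorem abs_mittagLefflerTerm {α l t : ℝ} (hα : 0 < α) (ht : 0 ≤ t) (k : ℕ) :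
    |mittagLefflerTerm α l k t| = mittagLefflerTerm α (-|l|) k t := by
  have hk : 0 < α * ((k : ℝ) + 1) := by positivity
  rw [mittagLefflerTerm, mittagLefflerTerm, neg_neg, abs_mul, abs_div, abs_pow, abs_neg,
    abs_of_pos (Real.Gamma_pos_of_pos hk), abs_of_nonneg (Real.rpow_nonneg ht _)]

theorem integrable_tsum_of_summable_integral_norm {X : Type*} [MeasurableSpace X] {μ : Measure X}
    {F : ℕ → X → ℝ} (hF : ∀ i, Integrable (F i) μ) (hsum : Summable fun i => ∫ a, ‖F i a‖ ∂μ) :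
    Integrable (fun a => ∑' i, F i a) μ := by
  have hfin : ∑' i, ∫⁻ a, ‖F i a‖ₑ ∂μ ≠ ⊤ := by
    have (i : ℕ) : ∫⁻ a, ‖F i a‖ₑ ∂μ = ENNReal.ofReal (∫ a, ‖F i a‖ ∂μ) :=
      (ofReal_integral_norm_eq_lintegral_enorm (hF i)).symm
    simp_rw [this]
    rw [← ENNReal.ofReal_tsum_of_nonneg (fun i => integral_nonneg fun a => norm_nonneg _) hsum]
    exact ENNReal.ofReal_ne_top
  have hmeas : ∀ i, AEMeasurable (fun a => ‖F i a‖ₑ) μ := fun i => (hF i).1.enorm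
  rw [← lintegral_tsum hmeas] at hfin
  have hae : ∀ᵐ a ∂μ, Summable fun i => F i a := by
    filter_upwards [ae_lt_top' (AEMeasurable.tsum hmeas) hfin] with a ha
    exact (tsum_enorm_ne_top_iff_summable_norm.1 ha.ne).of_norm
  refine ⟨aestronglyMeasurable_of_tendsto_ae atTop
    (f := fun n a => ∑ i ∈ Finset.range n, F i a) (fun n => ?_) ?_, ?_⟩
  · exact (integrable_finsetSum _ fun i _ => hF i).1
  · filter_upwards [hae] with a ha using ha.hasSum.tendsto_sum_nat
  · exact (lintegral_mono fun a => enorm_tsum_le_tsum_enorm).trans_lt hfin.lt_top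

/-- Termwise integration by beta integrals; absolute convergence is the same computation with l
replaced by -|l|. The case q = 1 shows that the density integrates to the Mittag-Leffler function,
the case q = 1 - α computes its Caputo derivative. -/
theorem integral_mul_mittagLefflerDensity {α q l t : ℝ} (hα : 0 < α) (hq : 0 < q) (ht : 0 < t)
    (hs : Summable fun k : ℕ => (|l| * t ^ α) ^ k / Real.Gamma (α * k + α + q)) :
    IntervalIntegrable (fun s => (t - s) ^ (q - 1) * mittagLefflerDensity α l s) volume 0 t ∧
    ∫ s in (0 : ℝ)..t, (t - s) ^ (q - 1) * mittagLefflerDensity α l s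
      = Real.Gamma q * t ^ (q - 1 + α) * (-l)
        * ∑' k : ℕ, (-l * t ^ α) ^ k / Real.Gamma (α * k + α + q) := by
  set F : ℕ → ℝ → ℝ := fun k s => (t - s) ^ (q - 1) * mittagLefflerTerm α l k s with hF
  have hFi : ∀ k, Integrable (F k) (volume.restrict (Ioc 0 t)) := fun k =>
    (intervalIntegrable_iff_integrableOn_Ioc_of_le ht.le).1
      (integral_mul_mittagLefflerTerm hα hq ht k).1
  have hFn : ∀ k, ∫ s in Ioc 0 t, ‖F k s‖
      = Real.Gamma q * t ^ (q - 1 + α) * |l| * ((|l| * t ^ α) ^ k / Real.Gamma (α * k + α + q)) := by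
    intro k
    have h := (integral_mul_mittagLefflerTerm (l := -|l|) hα hq ht k).2
    rw [neg_neg, intervalIntegral.integral_of_le ht.le] at h
    rw [← h]
    refine setIntegral_congr_fun measurableSet_Ioc fun s hs => ?_
    simp only [F]
    rw [norm_mul, Real.norm_eq_abs (mittagLefflerTerm _ _ _ _), abs_mittagLefflerTerm hα hs.1.le,
      Real.norm_of_nonneg (Real.rpow_nonneg (sub_nonneg.2 hs.2) _)]
  have hsum : Summable fun k => ∫ s in Ioc 0 t, ‖F k s‖ := by
    simp_rw [hFn]
    exact hs.mul_left _
  have e : ∀ s, ∑' k, F k s = (t - s) ^ (q - 1) * mittagLefflerDensity α l s := fun s => by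
    rw [mittagLefflerDensity, ← tsum_mul_left]
  constructor
  · rw [intervalIntegrable_iff_integrableOn_Ioc_of_le ht.le]
    simp_rw [← e]
    exact integrable_tsum_of_summable_integral_norm hFi hsum
  · have h := integral_tsum_of_summable_integral_norm hFi hsum
    simp_rw [e] at h
    rw [intervalIntegral.integral_of_le ht.le, ← h, ← tsum_mul_left]
    refine tsum_congr fun k => ?_
    rw [← (integral_mul_mittagLefflerTerm hα hq ht k).2, intervalIntegral.integral_of_le ht.le]

theorem mittagLeffler_zero (α : ℝ) : mittagLeffler α 0 = 1 := by
  rw [mittagLeffler, tsum_eq_single 0]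
  · simp
  · intro k hk
    simp [hk]

theorem isPrimitiveOn_mittagLeffler {α b : ℝ} (l : ℝ) (hα : 0 < α) (hb : 0 ≤ b) :
    IsPrimitiveOn (mittagLefflerDensity α l) (fun t => mittagLeffler α (-l * t ^ α)) 0 b := by
  have hs : ∀ x : ℝ, Summable fun k : ℕ => x ^ k / Real.Gamma (α * k + α + 1) := by
    intro x
    rcases eq_or_ne x 0 with rfl | hx
    · refine summable_of_ne_finset_zero (s := {0}) fun k hk => ?_
      simp [Finset.mem_singleton.not.1 hk]
    have h := ((summable_nat_add_iff 1).2 (summable_mittagLeffler hα x)).mul_left x⁻¹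
    refine h.congr fun k => ?_
    rw [show α * ((k + 1 : ℕ) : ℝ) + 1 = α * k + α + 1 by push_cast; ring, pow_succ]
    field_simp
  have key : ∀ t, 0 < t → IntervalIntegrable (mittagLefflerDensity α l) volume 0 t ∧
      mittagLeffler α (-l * t ^ α) = 1 + ∫ s in (0 : ℝ)..t, mittagLefflerDensity α l s := by
    intro t ht
    obtain ⟨h1, h2⟩ := integral_mul_mittagLefflerDensity hα one_pos ht (l := l) (hs _)
    simp only [sub_self, Real.rpow_zero, one_mul, Real.Gamma_one, zero_add] at h1 h2
    refine ⟨h1, ?_⟩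
    rw [h2, mittagLeffler, (summable_mittagLeffler hα _).tsum_eq_zero_add, ← tsum_mul_left]
    congr 1
    · simp
    · refine tsum_congr fun k => ?_
      rw [show α * ((k + 1 : ℕ) : ℝ) + 1 = α * k + α + 1 by push_cast; ring, pow_succ]
      ring
  have h0 : mittagLeffler α (-l * (0 : ℝ) ^ α) = 1 := by
    rw [Real.zero_rpow hα.ne', mul_zero, mittagLeffler_zero]
  refine ⟨?_, fun t ht => ?_⟩
  · rcases hb.eq_or_lt with rfl | hb
    · simp
    · exact (key b hb).1
  · simp only [h0]
    rcases ht.1.eq_or_lt with rfl | ht0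
    · rw [h0, intervalIntegral.integral_same, add_zero]
    · exact (key t ht0).2

theorem abelIntegral_mittagLefflerDensity {α t : ℝ} (l : ℝ) (hα : 0 < α) (hα' : α < 1) (ht : 0 < t) :
    abelIntegral α (mittagLefflerDensity α l) 0 t
      = -(l * Real.Gamma (1 - α)) * mittagLeffler α (-l * t ^ α) := by
  have e : ∀ k : ℕ, α * k + α + (1 - α) = α * k + 1 := fun k => by ring
  have h := (integral_mul_mittagLefflerDensity (q := 1 - α) hα (sub_pos.2 hα') ht (l := l) (by
    simp_rw [e]; exact summable_mittagLeffler hα _)).2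
  simp_rw [e] at h
  rw [show 1 - α - 1 = -α by ring, neg_add_cancel, Real.rpow_zero] at h
  simp only [abelIntegral, smul_eq_mul]
  rw [h, mittagLeffler]
  ring

end MittagLeffler

/-! ### Sign, monotonicity and lower bound of the Mittag-Leffler function -/

section MittagLefflerBounds

theorem IsPrimitiveOn.comp_sub {E : Type*} [NormedAddCommGroup E] [NormedSpace ℝ E]
    {w u : ℝ → E} {b : ℝ} (a : ℝ) (h : IsPrimitiveOn w u 0 (b - a)) :
    IsPrimitiveOn (fun s => w (s - a)) (fun s => u (s - a)) a b := by
  constructor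
  · simpa using h.1.comp_sub_right a
  · intro t ht
    have h2 := h.2 (t - a) ⟨sub_nonneg.2 ht.1, sub_le_sub_right ht.2 a⟩
    simp only [intervalIntegral.integral_comp_sub_right, sub_self]
    exact h2

theorem abelIntegral_comp_sub {E : Type*} [NormedAddCommGroup E] [NormedSpace ℝ E]
    (α : ℝ) (w : ℝ → E) (a t : ℝ) :
    abelIntegral α (fun s => w (s - a)) a t = abelIntegral α w 0 (t - a) := by
  have := intervalIntegral.integral_comp_sub_right (a := a) (b := t)
    (fun s => ((t - a) - s) ^ (-α) • w s) a
  simpa [abelIntegral] using this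

/-- Comparison of two functions by means of their Caputo derivatives. -/
theorem le_of_abelIntegral_le {α a b : ℝ} (hα₀ : 0 < α) (hα : α < 1) {w u v y : ℝ → ℝ}
    (hu : IsPrimitiveOn w u a b) (hy : IsPrimitiveOn v y a b) (ha : u a ≤ y a)
    (h : ∀ᵐ t, t ∈ Ioo a b → y t < u t → abelIntegral α w a t ≤ abelIntegral α v a t) :
    ∀ t ∈ Icc a b, u t ≤ y t := by
  intro t ht
  have hab : a ≤ b := ht.1.trans ht.2
  refine sub_nonpos.1 (nonpos_of_abelIntegral_nonpos hα₀ hα (hu.sub hy) (sub_nonpos.2 ha) ?_ t ht)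
  filter_upwards [h, ae_intervalIntegrable_abel hα hab hu.1, ae_intervalIntegrable_abel hα hab hy.1]
    with s h1 h2 h3 hs hpos
  have := h1 hs (sub_pos.1 hpos)
  simp only [abelIntegral, smul_sub]
  rw [intervalIntegral.integral_sub (h2 hs) (h3 hs)]
  exact sub_nonpos.2 this

/-- Comparison of t ↦ E_α(-x t^α) with zero on [0, 1], evaluated at t = 1: wherever the function is
negative its Caputo derivative is nonnegative. -/
theorem mittagLeffler_neg_nonneg {α x : ℝ} (hα₀ : 0 < α) (hα : α < 1) (hx : 0 ≤ x) :
    0 ≤ mittagLeffler α (-x) := by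
  have hz := isPrimitiveOn_mittagLeffler x hα₀ zero_le_one
  have h0 : IsPrimitiveOn (fun _ => (0 : ℝ)) (fun _ => (0 : ℝ)) 0 1 := ⟨by simp, by simp⟩
  have hG : 0 < Real.Gamma (1 - α) := Real.Gamma_pos_of_pos (sub_pos.2 hα)
  have := le_of_abelIntegral_le hα₀ hα h0 hz (by
      simp [Real.zero_rpow hα₀.ne', mittagLeffler_zero]) (by
    refine Eventually.of_forall fun t ht hneg => ?_
    rw [abelIntegral_mittagLefflerDensity x hα₀ hα ht.1]
    have : 0 ≤ x * Real.Gamma (1 - α) := by positivity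
    simp only [abelIntegral, smul_zero, intervalIntegral.integral_zero]
    nlinarith) 1 ⟨zero_le_one, le_rfl⟩
  simpa using this

theorem mittagLeffler_neg_anti {α x y : ℝ} (hα₀ : 0 < α) (hα : α < 1) (hx : 0 ≤ x) (hxy : x ≤ y) :
    mittagLeffler α (-y) ≤ mittagLeffler α (-x) := by
  have hG : 0 < Real.Gamma (1 - α) := Real.Gamma_pos_of_pos (sub_pos.2 hα)
  have := le_of_abelIntegral_le hα₀ hα (isPrimitiveOn_mittagLeffler y hα₀ zero_le_one)
    (isPrimitiveOn_mittagLeffler x hα₀ zero_le_one) (by simp [Real.zero_rpow hα₀.ne']) (by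
    refine Eventually.of_forall fun t ht hlt => ?_
    rw [abelIntegral_mittagLefflerDensity y hα₀ hα ht.1,
      abelIntegral_mittagLefflerDensity x hα₀ hα ht.1]
    have ht0 : 0 ≤ t ^ α := Real.rpow_nonneg ht.1.le _
    have hy0 : 0 ≤ mittagLeffler α (-y * t ^ α) := by
      rw [neg_mul]
      exact mittagLeffler_neg_nonneg hα₀ hα (mul_nonneg (hx.trans hxy) ht0)
    have h1 : x * mittagLeffler α (-x * t ^ α) ≤ y * mittagLeffler α (-y * t ^ α) :=
      (mul_le_mul_of_nonneg_left hlt.le hx).trans (mul_le_mul_of_nonneg_right hxy hy0)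
    nlinarith) 1 ⟨zero_le_one, le_rfl⟩
  simpa using this

theorem isPrimitiveOn_inv_one_add_rpow {α c b : ℝ} (hα₀ : 0 < α) (hc : 0 ≤ c) (hb : 0 ≤ b) :
    IsPrimitiveOn (fun t : ℝ => -(c * (α * t ^ (α - 1))) / (1 + c * t ^ α) ^ 2)
      (fun t : ℝ => (1 + c * t ^ α)⁻¹) 0 b := by
  have hpos : ∀ t : ℝ, 0 ≤ t → 0 < 1 + c * t ^ α := fun t ht => by
    have := Real.rpow_nonneg ht α
    positivity
  have hcont : ∀ d, 0 ≤ d → ContinuousOn (fun t : ℝ => 1 + c * t ^ α) (uIcc 0 d) := fun d _ =>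
    continuousOn_const.add (continuousOn_const.mul
      (continuousOn_id.rpow_const fun _ _ => Or.inr hα₀.le))
  have hint : ∀ d, 0 ≤ d → IntervalIntegrable
      (fun t : ℝ => -(c * (α * t ^ (α - 1))) / (1 + c * t ^ α) ^ 2) volume 0 d := by
    intro d hd
    have h1 : IntervalIntegrable (fun t : ℝ => t ^ (α - 1)) volume 0 d :=
      intervalIntegral.intervalIntegrable_rpow' (by linarith)
    have h2 := h1.mul_continuousOn (g := fun t : ℝ => -(c * α) * ((1 + c * t ^ α) ^ 2)⁻¹) (by
      refine continuousOn_const.mul (((hcont d hd).pow 2).inv₀ fun t ht => ?_)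
      rw [uIcc_of_le hd] at ht
      exact pow_ne_zero 2 (hpos t ht.1).ne')
    refine h2.congr fun t _ => ?_
    simp only [div_eq_mul_inv]
    ring
  refine ⟨hint b hb, fun t ht => ?_⟩
  rw [intervalIntegral.integral_eq_sub_of_hasDerivAt_of_le ht.1 (f := fun t : ℝ => (1 + c * t ^ α)⁻¹)
    ?_ ?_ (hint t ht.1)]
  · ring
  · rw [← uIcc_of_le ht.1]
    refine (hcont t ht.1).inv₀ fun s hs => ?_
    rw [uIcc_of_le ht.1] at hs
    exact (hpos s hs.1).ne'
  · intro s hs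
    exact (((Real.hasDerivAt_rpow_const (Or.inl hs.1.ne')).const_mul c).const_add 1).inv
      (hpos s hs.1.le).ne'

/-- Lower bound for the Mittag-Leffler function on the negative half-line. -/
theorem inv_le_mittagLeffler {α l t : ℝ} (hα₀ : 0 < α) (hα : α < 1) (hl : 0 ≤ l) (ht : 0 ≤ t) :
    (1 + l * Real.Gamma (1 - α) * t ^ α)⁻¹ ≤ mittagLeffler α (-l * t ^ α) := by
  have hG : 0 < Real.Gamma (1 - α) := Real.Gamma_pos_of_pos (sub_pos.2 hα)
  set c := l * Real.Gamma (1 - α) with hc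
  have hc0 : 0 ≤ c := by positivity
  have hφ := isPrimitiveOn_inv_one_add_rpow hα₀ hc0 ht
  refine le_of_abelIntegral_le hα₀ hα hφ (isPrimitiveOn_mittagLeffler l hα₀ ht)
    (by simp [Real.zero_rpow hα₀.ne', mittagLeffler_zero]) ?_ t ⟨ht, le_rfl⟩
  filter_upwards [ae_intervalIntegrable_abel hα ht hφ.1] with r hr hr0 hlt
  rw [abelIntegral_mittagLefflerDensity l hα₀ hα hr0.1, ← hc]
  have hrI : r ∈ Icc 0 t := Ioo_subset_Icc_self hr0
  have h0I : (0 : ℝ) ∈ Icc 0 t := ⟨le_rfl, ht⟩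
  have hrpos : 0 < r ^ α := Real.rpow_pos_of_pos hr0.1 _
  -- The function φ(t) = 1/(1 + c t^α) decreases and (r - s)^{-α} ≥ r^{-α}, so the Abel integral is
  -- at most r^{-α}(φ(r) - φ(0)) = -c φ(r). The Mittag-Leffler function satisfies the corresponding
  -- identity with equality.
  have h1 : abelIntegral α (fun t : ℝ => -(c * (α * t ^ (α - 1))) / (1 + c * t ^ α) ^ 2) 0 r
      ≤ ∫ s in (0 : ℝ)..r, r ^ (-α) * (-(c * (α * s ^ (α - 1))) / (1 + c * s ^ α) ^ 2) := by
    refine intervalIntegral.integral_mono_on_of_le_Ioo hr0.1.le (hr hr0)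
      ((hφ.intervalIntegrable_of_mem h0I hrI).const_mul _) fun s hs => ?_
    rw [smul_eq_mul]
    refine mul_le_mul_of_nonpos_right ?_ ?_
    · exact Real.rpow_le_rpow_of_nonpos (by linarith [hs.2]) (by linarith [hs.1]) (by linarith)
    · refine div_nonpos_of_nonpos_of_nonneg ?_ (sq_nonneg _)
      have := Real.rpow_nonneg hs.1.le (α - 1)
      exact neg_nonpos.2 (by positivity)
  refine h1.trans ?_
  rw [intervalIntegral.integral_const_mul, hφ.integral_eq_sub h0I hrI, Real.zero_rpow hα₀.ne',
    Real.rpow_neg hr0.1.le]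
  have e : (r ^ α)⁻¹ * ((1 + c * r ^ α)⁻¹ - (1 + c * 0)⁻¹) = -c * (1 + c * r ^ α)⁻¹ := by
    have : 0 < 1 + c * r ^ α := by positivity
    field_simp
    ring
  rw [e]
  nlinarith

end MittagLefflerBounds

/-! ### Boundedness and decay on a single piece -/

section Decay

variable {E : Type*} [NormedAddCommGroup E] [InnerProductSpace ℝ E] [CompleteSpace E]

theorem ae_abelIntegral_norm_sq_le {α a b : ℝ} (hα₀ : 0 ≤ α) (hα : α < 1) (hab : a ≤ b)
    {w z : ℝ → E} (hz : IsPrimitiveOn w z a b) :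
    ∀ᵐ t, t ∈ Ioo a b → abelIntegral α (fun s => 2 * inner ℝ (z s) (w s)) a t
      ≤ 2 * inner ℝ (z t) (abelIntegral α w a t) := by
  have := abelIntegral_le_inner (G := fun t => (2 : ℝ) • z t) hα₀ hα hab hz (hz.norm_sq hab) (by
    intro s _ t _
    rw [real_inner_smul_left, inner_sub_right, real_inner_self_eq_norm_sq]
    have h := norm_sub_sq_real (z t) (z s)
    nlinarith [sq_nonneg ‖z t - z s‖])
  simpa only [real_inner_smul_left] using this

/-- A dissipative fractional equation perturbed by the memory of the past stays bounded. -/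
theorem norm_le_of_dissipative {α a b μ D : ℝ} (hα₀ : 0 < α) (hα : α < 1) (hμ : 0 ≤ μ) (hD : 0 ≤ D)
    {w z : ℝ → E} (hz : IsPrimitiveOn w z a b)
    (h : ∀ᵐ t, t ∈ Ioo a b → inner ℝ (z t) (abelIntegral α w a t)
      ≤ -μ * ‖z t‖ ^ 2 + D * (t - a) ^ (-α) * ‖z t‖) :
    ∀ t ∈ Icc a b, ‖z t‖ ≤ ‖z a‖ + 2 * D := by
  intro t ht
  have hab : a ≤ b := ht.1.trans ht.2
  -- At a maximum point X = ‖z(t₀)‖, fractional integration gives X² ≤ ‖z(a)‖² + 2DX, which forces X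
  -- ≤ ‖z(a)‖ + 2D.
  obtain ⟨t₀, ht₀, hmax⟩ := isCompact_Icc.exists_isMaxOn (nonempty_Icc.2 hab) hz.continuousOn.norm
  refine (hmax ht).trans ?_
  have h1 := le_add_of_abelIntegral_le (c := 2 * D * ‖z t₀‖) hα₀ hα (hz.norm_sq hab) (by
    filter_upwards [h, ae_abelIntegral_norm_sq_le hα₀.le hα hab hz] with s h1 h2 hs
    have h3 := h1 hs
    have h4 := h2 hs
    have h5 : ‖z s‖ ≤ ‖z t₀‖ := hmax (Ioo_subset_Icc_self hs)
    have h6 : 0 ≤ D * (s - a) ^ (-α) := mul_nonneg hD (Real.rpow_nonneg (by linarith [hs.1]) _)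
    have h7 := mul_le_mul_of_nonneg_left h5 h6
    have h8 : 0 ≤ μ * ‖z s‖ ^ 2 := by positivity
    nlinarith) (by positivity) t₀ ht₀
  by_contra hlt
  push Not at hlt
  have := norm_nonneg (z a)
  have := norm_nonneg (z t₀)
  nlinarith

/-- Mittag-Leffler decay for a dissipative fractional equation perturbed by the memory of the
past. -/
theorem norm_sq_le_mittagLeffler_of_dissipative {α a b μ D N : ℝ} (hα₀ : 0 < α) (hα : α < 1)
    (hμ : 0 < μ) (hD : 0 ≤ D) (hN : 0 ≤ N) {w z : ℝ → E} (hz : IsPrimitiveOn w z a b)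
    (hzN : ∀ t ∈ Icc a b, ‖z t‖ ≤ N)
    (h : ∀ᵐ t, t ∈ Ioo a b → inner ℝ (z t) (abelIntegral α w a t)
      ≤ -μ * ‖z t‖ ^ 2 + D * (t - a) ^ (-α) * ‖z t‖) :
    ∀ t ∈ Icc a b, ‖z t‖ ^ 2 ≤ (1 + μ) * (2 * D * N / μ + N ^ 2)
      * mittagLeffler α (-(μ / Real.Gamma (1 - α)) * (t - a) ^ α) := by
  intro t ht
  have hab : a ≤ b := ht.1.trans ht.2
  have hG : 0 < Real.Gamma (1 - α) := Real.Gamma_pos_of_pos (sub_pos.2 hα)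
  set l := μ / Real.Gamma (1 - α) with hl
  have hlG : l * Real.Gamma (1 - α) = μ := div_mul_cancel₀ _ hG.ne'
  have hl0 : 0 ≤ l := by positivity
  -- The summand N² covers t - a ≤ 1, where E_α ≥ 1/(1 + μ); the summand 2DN/μ makes μK large enough
  -- to absorb the memory term when t - a > 1.
  set K := (1 + μ) * (2 * D * N / μ + N ^ 2) with hK
  have hK0 : 0 ≤ K := by positivity
  have hy : IsPrimitiveOn (fun s => K * mittagLefflerDensity α l (s - a))
      (fun s => K * mittagLeffler α (-l * (s - a) ^ α)) a b := by
    have := ((isPrimitiveOn_mittagLeffler l hα₀ (sub_nonneg.2 hab)).comp_sub a).clm_apply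
      (ContinuousLinearMap.mul ℝ ℝ K)
    simpa using this
  have hylow : ∀ s, a ≤ s → K * (1 + μ * (s - a) ^ α)⁻¹ ≤ K * mittagLeffler α (-l * (s - a) ^ α) := by
    intro s hs
    have := inv_le_mittagLeffler hα₀ hα hl0 (sub_nonneg.2 hs)
    rw [hlG] at this
    exact mul_le_mul_of_nonneg_left this hK0
  have hnear : ∀ s ∈ Icc a b, s - a ≤ 1 → ‖z s‖ ^ 2 ≤ K * mittagLeffler α (-l * (s - a) ^ α) := by
    intro s hs h1
    refine le_trans ?_ (hylow s hs.1)
    have hs0 : 0 ≤ s - a := sub_nonneg.2 hs.1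
    have h2 : (s - a) ^ α ≤ 1 := Real.rpow_le_one hs0 h1 hα₀.le
    have h3 : 0 ≤ (s - a) ^ α := Real.rpow_nonneg hs0 _
    rw [← div_eq_mul_inv, le_div_iff₀ (by positivity)]
    have h4 : ‖z s‖ ^ 2 ≤ N ^ 2 := pow_le_pow_left₀ (norm_nonneg _) (hzN s hs) 2
    have h5 : 0 ≤ 2 * D * N / μ := by positivity
    calc ‖z s‖ ^ 2 * (1 + μ * (s - a) ^ α) ≤ (2 * D * N / μ + N ^ 2) * (1 + μ * 1) := by
          gcongr
          linarith
      _ = K := by rw [hK]; ring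
  refine le_of_abelIntegral_le hα₀ hα (hz.norm_sq hab) hy
    (hnear a ⟨le_rfl, hab⟩ (by simp)) ?_ t ht
  filter_upwards [h, ae_abelIntegral_norm_sq_le hα₀.le hα hab hz] with s h1 h2 hs hlt
  have hsI := Ioo_subset_Icc_self hs
  have hτ : 1 < s - a := by
    by_contra hle
    exact absurd (hnear s hsI (not_lt.1 hle)) (not_le.2 hlt)
  have h3 := h1 hs
  refine (h2 hs).trans ?_
  have eJ : abelIntegral α (fun s => K * mittagLefflerDensity α l (s - a)) a s
      = K * (-μ * mittagLeffler α (-l * (s - a) ^ α)) := by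
    rw [abelIntegral_comp_sub α (fun s => K * mittagLefflerDensity α l s) a s, ← hlG,
      ← abelIntegral_mittagLefflerDensity l hα₀ hα (sub_pos.2 hs.1), abelIntegral, abelIntegral,
      ← intervalIntegral.integral_const_mul]
    refine intervalIntegral.integral_congr fun x _ => ?_
    simp only [smul_eq_mul]
    ring
  rw [eJ]
  have hτ0 : 0 < s - a := by linarith
  have hpos : 0 < (s - a) ^ α := Real.rpow_pos_of_pos hτ0 _
  have hone : 1 ≤ (s - a) ^ α := Real.one_le_rpow hτ.le hα₀.le
  -- Half of the dissipation absorbs the memory. Where ‖z‖² > K E_α, the total is at most -2μK E_α +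
  -- μK E_α, the Abel integral for the comparison function. The estimate uses 1 + μX ≤ (1 + μ)X for
  -- X = (s - a)^α ≥ 1.
  have h4 : 2 * (D * (s - a) ^ (-α) * ‖z s‖) ≤ μ * (K * (1 + μ * (s - a) ^ α)⁻¹) := by
    have h5 : 2 * (D * (s - a) ^ (-α) * ‖z s‖) ≤ 2 * D * N * ((s - a) ^ α)⁻¹ := by
      rw [Real.rpow_neg hτ0.le]
      have := mul_le_mul_of_nonneg_left (hzN s hsI)
        (show 0 ≤ 2 * D * ((s - a) ^ α)⁻¹ by positivity)
      nlinarith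
    refine h5.trans ?_
    rw [← div_eq_mul_inv, ← div_eq_mul_inv, ← mul_div_assoc, div_le_div_iff₀ hpos (by positivity)]
    have h6 : μ * K = (1 + μ) * (2 * D * N) + (1 + μ) * μ * N ^ 2 := by
      rw [hK]; field_simp
    rw [h6]
    have h7 : 2 * D * N * (1 + μ * (s - a) ^ α) ≤ 2 * D * N * ((1 + μ) * (s - a) ^ α) :=
      mul_le_mul_of_nonneg_left (by nlinarith) (by positivity)
    have h8 : 0 ≤ (1 + μ) * μ * N ^ 2 * (s - a) ^ α := by positivity
    nlinarith
  have h9 := mul_le_mul_of_nonneg_left (hylow s hs.1.le) hμ.le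
  nlinarith

end Decay

/-! ### Memory across impulses: gluing the pieces -/

section Pieces

variable {E : Type*} [NormedAddCommGroup E] [InnerProductSpace ℝ E] [CompleteSpace E]

/-- Splitting of the Caputo derivative with lower terminal `0` into the contribution of the past
pieces, which is controlled by their size, and that of the current piece. -/
theorem ae_norm_abelIntegral_sub_le {α : ℝ} (hα₀ : 0 ≤ α) (hα : α < 1) {m : ℕ} {a : ℕ → ℝ}
    (ha0 : a 0 = 0) (ha : ∀ k ≤ m, a k < a (k + 1)) {w : ℝ → E} {z : ℕ → ℝ → E}
    (hz : ∀ k ≤ m, IsPrimitiveOn w (z k) (a k) (a (k + 1))) {C : ℕ → ℝ} {k : ℕ} (hk : k ≤ m)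
    (hC : ∀ j < k, ∀ t ∈ Icc (a j) (a (j + 1)), ‖z j t‖ ≤ C j) :
    ∀ᵐ t, t ∈ Ioo (a k) (a (k + 1)) →
      ‖abelIntegral α w 0 t - abelIntegral α w (a k) t‖
        ≤ 2 * (∑ j ∈ Finset.range k, C j) * (t - a k) ^ (-α) := by
  filter_upwards [ae_intervalIntegrable_abel hα (ha k hk).le (hz k hk).1] with t hint ht
  have hle : ∀ j < k, a (j + 1) ≤ a k := by
    intro j hj
    induction k with
    | zero => omega
    | succ n ih =>
      rcases Nat.lt_succ_iff_lt_or_eq.1 hj with h | rfl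
      · have hn : n ≤ m := by omega
        refine le_trans ?_ (ha n hn).le
        clear ht hint hC
        have : ∀ i, j + 1 ≤ i → i ≤ n → a (j + 1) ≤ a i := by
          intro i hi
          induction i, hi using Nat.le_induction with
          | base => intro _; exact le_rfl
          | succ i hi ih' => intro hin; exact (ih' (by omega)).trans (ha i (by omega)).le
        exact this n h le_rfl
      · exact le_rfl
  have hpast : ∀ j < k, IntervalIntegrable (fun s => ((t - s) ^ (-α)) • w s) volume
      (a j) (a (j + 1)) := by
    intro j hj
    refine (hz j (by omega)).1.continuousOn_smul ?_
    refine ContinuousOn.rpow_const (by fun_prop) fun s hs => Or.inl ?_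
    rw [uIcc_of_le (ha j (by omega)).le] at hs
    linarith [hs.2, hle j hj, ht.1]
  have hsum := intervalIntegral.sum_integral_adjacent_intervals hpast
  have hpi := IntervalIntegrable.trans_iterate hpast
  rw [ha0] at hsum hpi
  rw [abelIntegral, abelIntegral, ← intervalIntegral.integral_add_adjacent_intervals hpi (hint ht),
    add_sub_cancel_right, ← hsum, mul_right_comm, Finset.mul_sum]
  refine (norm_sum_le _ _).trans (Finset.sum_le_sum fun j hj => ?_)
  have hjk := Finset.mem_range.1 hj
  have hlt := ha j (by omega)
  -- The oscillation of `z j` on its piece is at most twice its bound.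
  have h1 := norm_integral_abelKernel_le (N := 2 * C j) hα₀ hlt.le
    ((hle j hjk).trans_lt ht.1) (hz j (by omega)) fun r hr => by
      have h1 := hC j hjk _ (right_mem_Icc.2 hlt.le)
      have h2 := hC j hjk _ hr
      linarith [norm_sub_le (z j (a (j + 1))) (z j r)]
  have hC0 : 0 ≤ C j := (norm_nonneg _).trans (hC j hjk _ (right_mem_Icc.2 hlt.le))
  refine h1.trans ?_
  have h2 : (t - a (j + 1)) ^ (-α) ≤ (t - a k) ^ (-α) :=
    Real.rpow_le_rpow_of_nonpos (by linarith [ht.1]) (by linarith [hle j hjk]) (by linarith)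
  nlinarith

variable {α μ : ℝ} {m : ℕ} {a : ℕ → ℝ} {w : ℝ → E} {z : ℕ → ℝ → E}

/-- The lower terminal is moved from 0 to `a k`; by Cauchy–Schwarz the cost is the memory bound
times ‖z‖. -/
theorem ae_inner_abelIntegral_le (hα₀ : 0 ≤ α) (hα : α < 1)
    (ha0 : a 0 = 0) (ha : ∀ k ≤ m, a k < a (k + 1))
    (hz : ∀ k ≤ m, IsPrimitiveOn w (z k) (a k) (a (k + 1)))
    (heq : ∀ k ≤ m, ∀ᵐ t, t ∈ Ioo (a k) (a (k + 1)) →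
      inner ℝ (z k t) (abelIntegral α w 0 t) ≤ -μ * ‖z k t‖ ^ 2) {C : ℕ → ℝ} {k : ℕ} (hk : k ≤ m)
    (hC : ∀ j < k, ∀ t ∈ Icc (a j) (a (j + 1)), ‖z j t‖ ≤ C j) :
    ∀ᵐ t, t ∈ Ioo (a k) (a (k + 1)) → inner ℝ (z k t) (abelIntegral α w (a k) t)
      ≤ -μ * ‖z k t‖ ^ 2 + 2 * (∑ j ∈ Finset.range k, C j) * (t - a k) ^ (-α) * ‖z k t‖ := by
  filter_upwards [heq k hk, ae_norm_abelIntegral_sub_le hα₀ hα ha0 ha hz hk hC] with t h1 h2 ht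
  have h3 := h1 ht
  have h4 := mul_le_mul_of_nonneg_left (h2 ht) (norm_nonneg (z k t))
  have h5 := real_inner_le_norm (z k t) (-(abelIntegral α w 0 t - abelIntegral α w (a k) t))
  rw [norm_neg, inner_neg_right, inner_sub_right] at h5
  linarith

/-- Piece k starts at most at the previous bound 7^{k-1}‖z(0)‖ and gains at most four times the sum
of all earlier bounds. The base 7 closes the induction since 1/7 + 4/6 ≤ 1. -/
theorem norm_le_pow_mul_of_pieces (hα₀ : 0 < α) (hα : α < 1) (hμ : 0 ≤ μ)
    (ha0 : a 0 = 0) (ha : ∀ k ≤ m, a k < a (k + 1))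
    (hz : ∀ k ≤ m, IsPrimitiveOn w (z k) (a k) (a (k + 1)))
    (hjump : ∀ k < m, ‖z (k + 1) (a (k + 1))‖ ≤ ‖z k (a (k + 1))‖)
    (heq : ∀ k ≤ m, ∀ᵐ t, t ∈ Ioo (a k) (a (k + 1)) →
      inner ℝ (z k t) (abelIntegral α w 0 t) ≤ -μ * ‖z k t‖ ^ 2) :
    ∀ k ≤ m, ∀ t ∈ Icc (a k) (a (k + 1)), ‖z k t‖ ≤ 7 ^ k * ‖z 0 0‖ := by
  intro k
  induction k using Nat.strong_induction_on with
  | _ k ih =>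
    intro hk t ht
    have hC : ∀ j < k, ∀ t ∈ Icc (a j) (a (j + 1)), ‖z j t‖ ≤ 7 ^ j * ‖z 0 0‖ :=
      fun j hj => ih j hj (by omega)
    have hs : ∑ j ∈ Finset.range k, (7 : ℝ) ^ j * ‖z 0 0‖ = (7 ^ k - 1) / 6 * ‖z 0 0‖ := by
      rw [← Finset.sum_mul, geom_sum_eq (by norm_num)]
      norm_num
    have h := norm_le_of_dissipative hα₀ hα hμ (mul_nonneg zero_le_two
      (Finset.sum_nonneg fun j _ => by positivity)) (hz k hk)
      (ae_inner_abelIntegral_le hα₀.le hα ha0 ha hz heq hk hC) t ht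
    rw [hs] at h
    rcases Nat.eq_zero_or_pos k with rfl | hkpos
    · simpa [ha0] using h
    · obtain ⟨j, rfl⟩ : ∃ j, k = j + 1 := ⟨k - 1, by omega⟩
      have h1 := hjump j (by omega)
      have h2 := hC j (by omega) _ (right_mem_Icc.2 (ha j (by omega)).le)
      have h3 : 0 ≤ (7 : ℝ) ^ j * ‖z 0 0‖ := by positivity
      have h4 := norm_nonneg (z 0 0)
      rw [pow_succ] at h ⊢
      nlinarith

/-- Mittag-Leffler decay for dissipative fractional equations with finitely many nonexpansive
impulses. -/
theorem exists_norm_sq_le_mittagLeffler_of_pieces {α μ τ : ℝ} (hα₀ : 0 < α) (hα : α < 1)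
    (hμ : 0 < μ) (m : ℕ) (hτ : 0 ≤ τ) :
    ∃ lam C : ℝ, 0 < lam ∧ 0 ≤ C ∧ ∀ (a : ℕ → ℝ) (w : ℝ → E) (z : ℕ → ℝ → E),
      a 0 = 0 → a m = τ → (∀ k ≤ m, a k < a (k + 1)) →
      (∀ k ≤ m, IsPrimitiveOn w (z k) (a k) (a (k + 1))) →
      (∀ k < m, ‖z (k + 1) (a (k + 1))‖ ≤ ‖z k (a (k + 1))‖) →
      (∀ k ≤ m, ∀ᵐ t, t ∈ Ioo (a k) (a (k + 1)) →
        inner ℝ (z k t) (abelIntegral α w 0 t) ≤ -μ * ‖z k t‖ ^ 2) →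
      ∀ k ≤ m, ∀ t ∈ Icc (a k) (a (k + 1)),
        ‖z k t‖ ^ 2 ≤ C * ‖z 0 0‖ ^ 2 * mittagLeffler α (-lam * t ^ α) := by
  have hG : 0 < Real.Gamma (1 - α) := Real.Gamma_pos_of_pos (sub_pos.2 hα)
  have h2α : 0 < (2 : ℝ) ^ α := Real.rpow_pos_of_pos two_pos _
  set l := μ / Real.Gamma (1 - α) with hl
  have hlG : l * Real.Gamma (1 - α) = μ := div_mul_cancel₀ _ hG.ne'
  have hl0 : 0 < l := by positivity
  have hτα : 0 ≤ τ ^ α := Real.rpow_nonneg hτ _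
  -- The constant K of the one-piece decay estimate, for D = (7^m - 1)/3 and N = 7^m in units of
  -- ‖z(0)‖. The next constant, C₂, is the squared uniform bound divided by the lower bound of E_α
  -- for t ≤ 2τ.
  set C₁ : ℝ := (1 + μ) * (2 * ((7 ^ m - 1) / 3) * 7 ^ m / μ + (7 ^ m) ^ 2) with hC₁
  set C₂ : ℝ := (7 ^ m) ^ 2 * (1 + μ * τ ^ α) with hC₂
  have h7 : (1 : ℝ) ≤ 7 ^ m := one_le_pow₀ (by norm_num)
  have hC₁0 : 0 ≤ C₁ := by
    have : (0 : ℝ) ≤ 7 ^ m - 1 := by linarith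
    positivity
  have hC₂0 : 0 ≤ C₂ := by positivity
  -- The factor 2^{-α} pays for replacing t - τ by t/2 in the late regime.
  refine ⟨l / 2 ^ α, C₁ + C₂, by positivity, by positivity, ?_⟩
  intro a w z ha0 ham ha hz hjump heq k hk t ht
  have hb := norm_le_pow_mul_of_pieces hα₀ hα hμ.le ha0 ha hz hjump heq
  have hmono : ∀ i, i ≤ m + 1 → ∀ j ≤ i, a j ≤ a i := by
    intro i
    induction i with
    | zero => intro _ j hj; rw [Nat.le_zero.1 hj]
    | succ i ih =>
      intro hi j hj
      rcases Nat.le_succ_iff.1 hj with h | rfl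
      · exact (ih (by omega) j h).trans (ha i (by omega)).le
      · exact le_rfl
  have ht0 : 0 ≤ t := by
    rw [← ha0]
    exact (hmono k (by omega) 0 (Nat.zero_le _)).trans ht.1
  have htα : 0 ≤ t ^ α := Real.rpow_nonneg ht0 _
  have hEn : 0 ≤ mittagLeffler α (-(l / 2 ^ α) * t ^ α) := by
    rw [neg_mul]
    exact mittagLeffler_neg_nonneg hα₀ hα (by positivity)
  set N := ‖z 0 0‖
  have hN0 : 0 ≤ N := norm_nonneg _
  by_cases hlate : t ≤ 2 * τ
  · have h1 : ‖z k t‖ ^ 2 ≤ (7 ^ m) ^ 2 * N ^ 2 := by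
      rw [← mul_pow]
      refine pow_le_pow_left₀ (norm_nonneg _) ((hb k hk t ht).trans ?_) 2
      exact mul_le_mul_of_nonneg_right (pow_le_pow_right₀ (by norm_num) hk) hN0
    have h2 : t ^ α ≤ 2 ^ α * τ ^ α := by
      rw [← Real.mul_rpow zero_le_two hτ]
      exact Real.rpow_le_rpow ht0 hlate hα₀.le
    have h3 := inv_le_mittagLeffler hα₀ hα (l := l / 2 ^ α) (by positivity) ht0
    have h4 : l / 2 ^ α * Real.Gamma (1 - α) * t ^ α ≤ μ * τ ^ α := by
      calc l / 2 ^ α * Real.Gamma (1 - α) * t ^ α = μ * (t ^ α / 2 ^ α) := by rw [← hlG]; ring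
        _ ≤ μ * τ ^ α := by
          refine mul_le_mul_of_nonneg_left ?_ hμ.le
          rw [div_le_iff₀ h2α]
          linarith
    have h5 : (1 + μ * τ ^ α)⁻¹ ≤ mittagLeffler α (-(l / 2 ^ α) * t ^ α) := by
      refine le_trans ?_ h3
      gcongr
    have h6 : (7 ^ m) ^ 2 * N ^ 2 = C₂ * N ^ 2 * (1 + μ * τ ^ α)⁻¹ := by
      rw [hC₂]
      have : (1 + μ * τ ^ α) ≠ 0 := by positivity
      field_simp
    calc ‖z k t‖ ^ 2 ≤ C₂ * N ^ 2 * (1 + μ * τ ^ α)⁻¹ := h6 ▸ h1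
      _ ≤ C₂ * N ^ 2 * mittagLeffler α (-(l / 2 ^ α) * t ^ α) := by gcongr
      _ ≤ _ := by gcongr; linarith
  · push Not at hlate
    -- Past 2τ ≥ τ = a m, only the last piece remains.
    have hkm : k = m := by
      by_contra hne
      have h1 := hmono m (by omega) (k + 1) (by omega)
      linarith [ht.2]
    subst hkm
    have hC : ∀ j < k, ∀ t ∈ Icc (a j) (a (j + 1)), ‖z j t‖ ≤ 7 ^ j * N := fun j hj => hb j (by omega)
    have hs : 2 * ∑ j ∈ Finset.range k, (7 : ℝ) ^ j * N = (7 ^ k - 1) / 3 * N := by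
      rw [← Finset.sum_mul, geom_sum_eq (by norm_num)]
      norm_num
      ring
    have hdis := ae_inner_abelIntegral_le hα₀.le hα ha0 ha hz heq le_rfl hC
    rw [hs] at hdis
    have h1 := norm_sq_le_mittagLeffler_of_dissipative hα₀ hα hμ
      (mul_nonneg (by linarith) hN0) (by positivity) (hz k le_rfl) (hb k le_rfl) hdis t ht
    have h2 : (1 + μ) * (2 * ((7 ^ k - 1) / 3 * N) * (7 ^ k * N) / μ + (7 ^ k * N) ^ 2)
        = C₁ * N ^ 2 := by
      rw [hC₁]; ring
    rw [h2, ham, ← hl] at h1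
    have h3 : mittagLeffler α (-l * (t - τ) ^ α) ≤ mittagLeffler α (-(l / 2 ^ α) * t ^ α) := by
      rw [neg_mul, neg_mul]
      refine mittagLeffler_neg_anti hα₀ hα (by positivity) ?_
      rw [div_mul_eq_mul_div, mul_div_assoc, ← Real.div_rpow ht0 zero_le_two]
      refine mul_le_mul_of_nonneg_left (Real.rpow_le_rpow (by positivity) (by linarith) hα₀.le) hl0.le
    calc ‖z k t‖ ^ 2 ≤ C₁ * N ^ 2 * mittagLeffler α (-l * (t - τ) ^ α) := h1
      _ ≤ C₁ * N ^ 2 * mittagLeffler α (-(l / 2 ^ α) * t ^ α) := by gcongr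
      _ ≤ _ := by gcongr; linarith

end Pieces

/-! ### Matrix inequalities in the metric of Q -/

section MatrixFacts

open Matrix

variable {n : ℕ}

/-- An eigenvalue of M - cI shifted by c is an eigenvalue of M, so M - cI is positive semidefinite
for c = λ_min. Finiteness of the spectrum makes the infimum a genuine lower bound. -/
theorem lambdaMin_mul_dotProduct_le {M : Matrix (Fin n) (Fin n) ℝ} (hM : M.IsHermitian)
    (y : Fin n → ℝ) : lambdaMin M * (y ⬝ᵥ y) ≤ y ⬝ᵥ (M *ᵥ y) := by
  have hbdd : BddBelow {μ : ℝ | Module.End.HasEigenvalue (Matrix.toLin' M) μ} :=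
    (Module.End.finite_hasEigenvalue (Matrix.toLin' M)).bddBelow
  set c := lambdaMin M with hc
  have hM' : (M - c • (1 : Matrix (Fin n) (Fin n) ℝ)).IsHermitian :=
    hM.sub (by simp [Matrix.IsHermitian])
  have hpos : (M - c • (1 : Matrix (Fin n) (Fin n) ℝ)).PosSemidef := by
    rw [hM'.posSemidef_iff_eigenvalues_nonneg]
    intro i
    have hv := hM'.mulVec_eigenvectorBasis i
    set v : Fin n → ℝ := ⇑(hM'.eigenvectorBasis i) with hvdef
    have hne : v ≠ 0 := by
      intro h0
      apply hM'.eigenvectorBasis.orthonormal.ne_zero i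
      ext j
      exact congrFun h0 j
    have hmem : Module.End.HasEigenvalue (Matrix.toLin' M) (hM'.eigenvalues i + c) := by
      refine Module.End.hasEigenvalue_of_hasEigenvector (x := v) ⟨?_, hne⟩
      rw [Module.End.mem_eigenspace_iff, Matrix.toLin'_apply]
      rw [sub_mulVec, smul_mulVec, one_mulVec] at hv
      rw [add_smul]
      exact sub_eq_iff_eq_add.1 hv
    have hle : c ≤ hM'.eigenvalues i + c := csInf_le hbdd hmem
    exact le_add_iff_nonneg_left c |>.1 hle
  have h := hpos.dotProduct_mulVec_nonneg y
  rw [sub_mulVec, smul_mulVec, one_mulVec, dotProduct_sub, dotProduct_smul, smul_eq_mul] at h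
  simp only [star_trivial] at h
  linarith

theorem sqrt_facts {Q : Matrix (Fin n) (Fin n) ℝ} (hQ : Q.PosDef) :
    CFC.sqrt Q * CFC.sqrt Q = Q ∧ (CFC.sqrt Q)ᵀ = CFC.sqrt Q ∧
      invSqrt Q * CFC.sqrt Q = 1 ∧ (invSqrt Q)ᵀ = invSqrt Q := by
  have h1 : CFC.sqrt Q * CFC.sqrt Q = Q :=
    CFC.sqrt_mul_sqrt_self Q (Matrix.nonneg_iff_posSemidef.2 hQ.posSemidef)
  have h2 : (CFC.sqrt Q)ᵀ = CFC.sqrt Q := by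
    have := (Matrix.nonneg_iff_posSemidef.1 (CFC.sqrt_nonneg Q)).isHermitian
    rwa [Matrix.IsHermitian, conjTranspose_eq_transpose_of_trivial] at this
  have h3 : IsUnit (CFC.sqrt Q).det := by
    have := hQ.isUnit
    rw [Matrix.isUnit_iff_isUnit_det, ← h1, det_mul] at this
    exact isUnit_of_mul_isUnit_left this
  exact ⟨h1, h2, nonsing_inv_mul _ h3, by rw [invSqrt, transpose_nonsing_inv, h2]⟩

/-- The Loewner inequality is tested on Q^{1/2}v, which cancels the outer factors Q^{-1/2}. -/
theorem sq_dotProduct_mulVec_of_loewner {Q C : Matrix (Fin n) (Fin n) ℝ} (hQ : Q.PosDef) {η : ℝ}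
    (hη : η ≤ 1)
    (h : (invSqrt Q * C.transpose * Q * C * invSqrt Q - η • (1 : Matrix (Fin n) (Fin n) ℝ)) ≤ 0)
    (v : Fin n → ℝ) :
    (CFC.sqrt Q *ᵥ (C *ᵥ v)) ⬝ᵥ (CFC.sqrt Q *ᵥ (C *ᵥ v))
      ≤ (CFC.sqrt Q *ᵥ v) ⬝ᵥ (CFC.sqrt Q *ᵥ v) := by
  obtain ⟨h1, h2, h3, h4⟩ := sqrt_facts hQ
  have hp := Matrix.le_iff.1 h
  have := hp.dotProduct_mulVec_nonneg (CFC.sqrt Q *ᵥ v)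
  simp only [star_trivial, zero_sub, neg_sub, sub_mulVec, smul_mulVec, one_mulVec, dotProduct_sub,
    dotProduct_smul, smul_eq_mul] at this
  have e : (invSqrt Q * C.transpose * Q * C * invSqrt Q) *ᵥ (CFC.sqrt Q *ᵥ v)
      = invSqrt Q *ᵥ (C.transpose *ᵥ (CFC.sqrt Q *ᵥ (CFC.sqrt Q *ᵥ (C *ᵥ v)))) := by
    simp only [mulVec_mulVec]
    congr 1
    rw [mul_assoc _ (invSqrt Q), h3, mul_one]
    simp only [mul_assoc]
    rw [← mul_assoc (CFC.sqrt Q) (CFC.sqrt Q), h1]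
  have e2 : (CFC.sqrt Q *ᵥ v) ⬝ᵥ
      ((invSqrt Q * C.transpose * Q * C * invSqrt Q) *ᵥ (CFC.sqrt Q *ᵥ v))
      = (CFC.sqrt Q *ᵥ (C *ᵥ v)) ⬝ᵥ (CFC.sqrt Q *ᵥ (C *ᵥ v)) := by
    rw [e, dotProduct_mulVec, ← mulVec_transpose, h4, mulVec_mulVec, h3, one_mulVec,
      dotProduct_mulVec, ← mulVec_transpose, transpose_transpose, dotProduct_mulVec,
      ← mulVec_transpose, h2]
  have hnn : 0 ≤ (CFC.sqrt Q *ᵥ v) ⬝ᵥ (CFC.sqrt Q *ᵥ v) := by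
    simpa using dotProduct_star_self_nonneg (CFC.sqrt Q *ᵥ v)
  rw [e2] at this
  nlinarith

/-- Young's inequality 2⟨Qv, p⟩ ≤ r⁻¹|Qv|² + r|p|² together with |p| ≤ |Cv| produces exactly the
quadratic form inside λ_min, evaluated at Q^{1/2}v. -/
theorem two_mul_dotProduct_le_of_lambdaMin {Q C : Matrix (Fin n) (Fin n) ℝ} (hQ : Q.PosDef)
    {r : ℝ} (hr : 0 < r) {v p : Fin n → ℝ} (hp : p ⬝ᵥ p ≤ (C *ᵥ v) ⬝ᵥ (C *ᵥ v)) :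
    2 * ((CFC.sqrt Q *ᵥ v) ⬝ᵥ (CFC.sqrt Q *ᵥ (-v + p))) ≤
      -lambdaMin (-(invSqrt Q * (-(2 : ℝ) • Q + r⁻¹ • Q ^ 2 + r • (C.transpose * C)) * invSqrt Q))
        * ((CFC.sqrt Q *ᵥ v) ⬝ᵥ (CFC.sqrt Q *ᵥ v)) := by
  obtain ⟨h1, h2, h3, h4⟩ := sqrt_facts hQ
  have hQt : Qᵀ = Q := by rw [← h1, transpose_mul, h2]
  set N := -(2 : ℝ) • Q + r⁻¹ • Q ^ 2 + r • (C.transpose * C) with hN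
  have hNt : Nᵀ = N := by
    simp only [hN, transpose_add, transpose_smul, transpose_pow, transpose_mul,
      transpose_transpose, hQt]
  have hherm : (-(invSqrt Q * N * invSqrt Q)).IsHermitian := by
    rw [Matrix.IsHermitian, conjTranspose_eq_transpose_of_trivial, transpose_neg, transpose_mul,
      transpose_mul, hNt, h4, mul_assoc]
  have hmin := lambdaMin_mul_dotProduct_le hherm (CFC.sqrt Q *ᵥ v)
  have e : (CFC.sqrt Q *ᵥ v) ⬝ᵥ ((-(invSqrt Q * N * invSqrt Q)) *ᵥ (CFC.sqrt Q *ᵥ v))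
      = -(v ⬝ᵥ (N *ᵥ v)) := by
    rw [neg_mulVec, dotProduct_neg, mulVec_mulVec, mul_assoc, h3, mul_one, ← mulVec_mulVec,
      dotProduct_mulVec, ← mulVec_transpose, h4, mulVec_mulVec, h3, one_mulVec]
  have hRR : ∀ x y : Fin n → ℝ, (CFC.sqrt Q *ᵥ x) ⬝ᵥ (CFC.sqrt Q *ᵥ y) = (Q *ᵥ x) ⬝ᵥ y := by
    intro x y
    rw [dotProduct_mulVec, ← mulVec_transpose, h2, mulVec_mulVec, h1]
  have hNv : v ⬝ᵥ (N *ᵥ v) = -2 * ((Q *ᵥ v) ⬝ᵥ v) + r⁻¹ * ((Q *ᵥ v) ⬝ᵥ (Q *ᵥ v))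
      + r * ((C *ᵥ v) ⬝ᵥ (C *ᵥ v)) := by
    rw [hN, add_mulVec, add_mulVec, smul_mulVec, smul_mulVec, smul_mulVec, dotProduct_add,
      dotProduct_add, dotProduct_smul, dotProduct_smul, dotProduct_smul, pow_two, ← mulVec_mulVec,
      ← mulVec_mulVec, dotProduct_mulVec v Q (Q *ᵥ v), ← mulVec_transpose, hQt,
      dotProduct_mulVec v Cᵀ, ← mulVec_transpose, transpose_transpose, dotProduct_comm v]
    simp only [smul_eq_mul]
  have hyoung : 2 * ((Q *ᵥ v) ⬝ᵥ p) ≤ r⁻¹ * ((Q *ᵥ v) ⬝ᵥ (Q *ᵥ v)) + r * (p ⬝ᵥ p) := by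
    have h5 : 0 ≤ (Q *ᵥ v - r • p) ⬝ᵥ (Q *ᵥ v - r • p) := by
      simpa using dotProduct_star_self_nonneg (Q *ᵥ v - r • p)
    simp only [sub_dotProduct, dotProduct_sub, smul_dotProduct, dotProduct_smul, smul_eq_mul] at h5
    rw [dotProduct_comm p (Q *ᵥ v)] at h5
    have h6 := mul_nonneg (inv_pos.2 hr).le h5
    have h8 : r⁻¹ * (((Q *ᵥ v) ⬝ᵥ (Q *ᵥ v) - r * ((Q *ᵥ v) ⬝ᵥ p)) -
        (r * ((Q *ᵥ v) ⬝ᵥ p) - r * (r * (p ⬝ᵥ p))))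
        = r⁻¹ * ((Q *ᵥ v) ⬝ᵥ (Q *ᵥ v)) + r * (p ⬝ᵥ p) - 2 * ((Q *ᵥ v) ⬝ᵥ p) := by
      field_simp
      ring
    linarith
  rw [e, hNv] at hmin
  rw [hRR v (-v + p), dotProduct_add, dotProduct_neg]
  have := mul_le_mul_of_nonneg_left hp hr.le
  linarith

end MatrixFacts

/-! ### Nonexpansive projection; Euclidean-valued absolute continuity -/

section Projection

variable {n : ℕ}

/-- Adding the variational inequalities at the two projections gives ‖p - q‖² ≤ ⟨y - z, p - q⟩;
Cauchy–Schwarz concludes. -/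
theorem norm_projOnto_sub_le {K : Set (EuclideanSpace ℝ (Fin n))} (hne : K.Nonempty)
    (hcl : IsClosed K) (hcv : Convex ℝ K) (y z : EuclideanSpace ℝ (Fin n)) :
    ‖projOnto K y - projOnto K z‖ ≤ ‖y - z‖ := by
  have key : ∀ y, ∀ w ∈ K, inner ℝ (y - projOnto K y) (w - projOnto K y) ≤ 0 := by
    intro y
    obtain ⟨hv, hvm⟩ := projOnto_spec hne hcl hcv y
    have : Nonempty K := ⟨⟨_, hv⟩⟩
    refine (norm_eq_iInf_iff_real_inner_le_zero hcv hv).1 (le_antisymm ?_ ?_)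
    · exact le_ciInf fun w => hvm w w.2
    · exact ciInf_le (f := fun w : K => ‖y - w‖)
        ⟨0, Set.forall_mem_range.2 fun _ => norm_nonneg _⟩ ⟨_, hv⟩
  have h1 := key y _ (projOnto_spec hne hcl hcv z).1
  have h2 := key z _ (projOnto_spec hne hcl hcv y).1
  set p := projOnto K y
  set q := projOnto K z
  have h3 : ‖p - q‖ ^ 2 ≤ inner ℝ (y - z) (p - q) := by
    rw [← real_inner_self_eq_norm_sq]
    simp only [inner_sub_left, inner_sub_right] at h1 h2 ⊢
    have := real_inner_comm p q
    linarith
  have h4 := h3.trans (real_inner_le_norm _ _)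
  by_contra hlt
  push Not at hlt
  nlinarith [norm_nonneg (y - z)]

theorem AbsolutelyContinuousOnInterval.isPrimitiveOn_euclidean {z : ℝ → EuclideanSpace ℝ (Fin n)}
    {a b : ℝ} (hab : a ≤ b) (hz : AbsolutelyContinuousOnInterval z a b) :
    IsPrimitiveOn (deriv z) z a b := by
  have hcoord : ∀ i, IsPrimitiveOn (deriv fun t => z t i) (fun t => z t i) a b := by
    intro i
    refine AbsolutelyContinuousOnInterval.isPrimitiveOn ?_
    rw [absolutelyContinuousOnInterval_iff] at hz ⊢
    intro ε hε
    obtain ⟨δ, hδ, H⟩ := hz ε hε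
    refine ⟨δ, hδ, fun I hI hlt => lt_of_le_of_lt (Finset.sum_le_sum fun j _ => ?_) (H I hI hlt)⟩
    rw [dist_eq_norm, dist_eq_norm]
    exact PiLp.norm_apply_le (z (I.2 j).1 - z (I.2 j).2) i
  have hdecomp : ∀ v : EuclideanSpace ℝ (Fin n), v = ∑ i, v i • EuclideanSpace.single i (1 : ℝ) := by
    intro v
    ext j
    simp [Finset.sum_apply, Pi.single_apply]
  have hg : IsPrimitiveOn
      (fun s => ∑ i, deriv (fun t => z t i) s • (EuclideanSpace.single i (1 : ℝ) : EuclideanSpace ℝ (Fin n)))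
      z a b := by
    have hi : ∀ i, ∀ t ∈ Icc a b, IntervalIntegrable (fun s => deriv (fun t => z t i) s •
        (EuclideanSpace.single i (1 : ℝ) : EuclideanSpace ℝ (Fin n))) volume a t := fun i t ht =>
      ⟨((hcoord i).intervalIntegrable_of_mem ⟨le_rfl, hab⟩ ht).1.smul_const _,
        ((hcoord i).intervalIntegrable_of_mem ⟨le_rfl, hab⟩ ht).2.smul_const _⟩
    refine ⟨?_, fun t ht => ?_⟩
    · have := IntervalIntegrable.sum Finset.univ fun i _ => hi i b ⟨hab, le_rfl⟩
      simpa [Finset.sum_fn] using this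
    · rw [intervalIntegral.integral_finsetSum fun i _ => hi i t ht]
      simp_rw [intervalIntegral.integral_smul_const]
      rw [hdecomp (z t), hdecomp (z a), ← Finset.sum_add_distrib]
      refine Finset.sum_congr rfl fun i _ => ?_
      rw [← add_smul, ← (hcoord i).2 t ht]
  refine hg.congr_ae hab ?_ fun _ _ => rfl
  filter_upwards [hg.ae_hasDerivAt] with t ht htab
  exact (ht htab).deriv.symm

end Projection

/-! ### Decomposition of a solution into pieces -/

namespace ImpulsiveProjectionNetwork

variable {n : ℕ}

theorem node_of_le (S : ImpulsiveProjectionNetwork n) (T : ℝ) {k : ℕ} (hk : k ≤ S.m) :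
    S.node T k = S.t k := if_pos hk

theorem node_lt (S : ImpulsiveProjectionNetwork n) {T : ℝ} (hT : S.t S.m < T) {k : ℕ}
    (hk : k ≤ S.m) : S.node T k < S.node T (k + 1) := by
  rcases hk.eq_or_lt with rfl | hlt
  · rw [S.node_of_le T le_rfl, node, if_neg (by omega)]
    exact hT
  · rw [S.node_of_le T hk, S.node_of_le T hlt]
    exact S.t_lt k hlt

theorem t_nonneg (S : ImpulsiveProjectionNetwork n) : ∀ k ≤ S.m, 0 ≤ S.t k := by
  intro k
  induction k with
  | zero => intro _; exact S.t_zero.ge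
  | succ k ih => intro hk; exact (ih (by omega)).trans (S.t_lt k hk).le

/-- On each piece a solution agrees with a primitive of its derivative which starts from the
value after the impulse. -/
theorem IsSolution.exists_piece {S : ImpulsiveProjectionNetwork n} {T : ℝ} (hT : S.t S.m < T)
    {x₀ : EuclideanSpace ℝ (Fin n)} {x : ℝ → EuclideanSpace ℝ (Fin n)} (hx : S.IsSolution T x₀ x)
    (k : ℕ) (hk : k ≤ S.m) :
    ∃ z : ℝ → EuclideanSpace ℝ (Fin n),
      IsPrimitiveOn (deriv x) z (S.node T k) (S.node T (k + 1)) ∧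
      (∀ t ∈ Ioc (S.node T k) (S.node T (k + 1)), z t = x t) ∧
      (k = 0 → z 0 = x₀) ∧
      (1 ≤ k → z (S.t k) = x (S.t k) + S.U k (x (S.t k))) := by
  have hlt := S.node_lt hT hk
  rcases Nat.eq_zero_or_pos k with rfl | hpos
  · have h0 : S.node T 0 = 0 := by rw [S.node_of_le T hk, S.t_zero]
    refine ⟨x, ?_, fun _ _ => rfl, fun _ => hx.initial, fun h => absurd h (by omega)⟩
    rw [h0] at hlt ⊢
    exact hx.absCont_first.isPrimitiveOn_euclidean hlt.le
  · obtain ⟨z, hz, hxz⟩ := hx.absCont k hpos hk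
    refine ⟨z, (hz.isPrimitiveOn_euclidean hlt.le).congr_ae hlt.le ?_ fun _ _ => rfl,
      fun t ht => (hxz ht).symm, fun h => absurd h (by omega), fun _ => ?_⟩
    · refine Eventually.of_forall fun t ht => ?_
      refine Filter.EventuallyEq.deriv_eq ?_
      filter_upwards [Ioo_mem_nhds ht.1 ht.2] with s hs
      exact (hxz (Ioo_subset_Ioc_self hs)).symm
    · have hcont : ContinuousWithinAt z (Icc (S.node T k) (S.node T (k + 1))) (S.node T k) := by
        have := hz.continuousOn
        rw [uIcc_of_le hlt.le] at this
        exact this _ (left_mem_Icc.2 hlt.le)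
      rw [← S.node_of_le T hk]
      have hjump := hx.jump k hpos hk
      rw [← S.node_of_le T hk] at hjump
      -- The absolutely continuous extension and the solution share their right limit at the node,
      -- so the extension starts at the value after the jump.
      refine tendsto_nhds_unique ?_ hjump
      have h1 : Tendsto z (𝓝[>] (S.node T k)) (𝓝 (z (S.node T k))) :=
        hcont.mono_of_mem_nhdsWithin (Icc_mem_nhdsGT hlt)
      refine h1.congr' ?_
      filter_upwards [Ioc_mem_nhdsGT hlt] with s hs
      exact (hxz hs).symm

end ImpulsiveProjectionNetwork

/-! ### Dissipativity of the network and conclusion -/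

section Main

variable {n : ℕ}

/-- The continuous linear map of a matrix on Euclidean space. -/
noncomputable def matrixCLM (R : Matrix (Fin n) (Fin n) ℝ) :
    EuclideanSpace ℝ (Fin n) →L[ℝ] EuclideanSpace ℝ (Fin n) :=
  LinearMap.toContinuousLinearMap (Matrix.toEuclideanLin R)

theorem ofLp_matrixCLM (R : Matrix (Fin n) (Fin n) ℝ) (v : EuclideanSpace ℝ (Fin n)) :
    (matrixCLM R v).ofLp = Matrix.mulVec R v.ofLp := rfl

theorem inner_eq_dotProduct (u v : EuclideanSpace ℝ (Fin n)) :
    inner ℝ u v = u.ofLp ⬝ᵥ v.ofLp := by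
  rw [EuclideanSpace.inner_eq_star_dotProduct, star_trivial, dotProduct_comm]

theorem norm_sq_eq_dotProduct (v : EuclideanSpace ℝ (Fin n)) : ‖v‖ ^ 2 = v.ofLp ⬝ᵥ v.ofLp := by
  rw [← real_inner_self_eq_norm_sq, inner_eq_dotProduct]

/-- Dissipativity of the projection vector field in the metric of `Q`. -/
theorem ImpulsiveProjectionNetwork.two_mul_inner_le (S : ImpulsiveProjectionNetwork n)
    {xstar : EuclideanSpace ℝ (Fin n)} (hstar : S.IsEquilibrium xstar)
    {Q : Matrix (Fin n) (Fin n) ℝ} (hQ : Q.PosDef) {r : ℝ} (hr : 0 < r)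
    (x : EuclideanSpace ℝ (Fin n)) :
    2 * inner ℝ (matrixCLM (CFC.sqrt Q) (x - xstar))
        (matrixCLM (CFC.sqrt Q) (-x + S.proj x)) ≤
      -lambdaMin (-(invSqrt Q * (-(2 : ℝ) • Q + r⁻¹ • Q ^ 2
          + r • ((1 - S.ρ • S.A).transpose * (1 - S.ρ • S.A))) * invSqrt Q))
        * ‖matrixCLM (CFC.sqrt Q) (x - xstar)‖ ^ 2 := by
  have hfix : S.proj xstar = xstar := by
    have := hstar.1
    rwa [neg_add_eq_zero, eq_comm] at this
  have hp : ‖S.proj x - xstar‖ ≤ ‖matrixCLM (1 - S.ρ • S.A) (x - xstar)‖ := by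
    conv_lhs => rw [← hfix]
    refine (norm_projOnto_sub_le S.K_nonempty S.K_closed S.K_convex _ _).trans (le_of_eq ?_)
    congr 1
    have h1 : ∀ v, matrixCLM (1 - S.ρ • S.A) v = v - S.ρ • Matrix.toEuclideanLin S.A v := fun v => by
      apply WithLp.ofLp_injective
      rw [ofLp_matrixCLM, Matrix.sub_mulVec, Matrix.one_mulVec, Matrix.smul_mulVec]
      rfl
    rw [h1, map_sub, smul_sub]
    abel
  have hp' : (S.proj x - xstar).ofLp ⬝ᵥ (S.proj x - xstar).ofLp
      ≤ (Matrix.mulVec (1 - S.ρ • S.A) (x - xstar).ofLp) ⬝ᵥ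
        (Matrix.mulVec (1 - S.ρ • S.A) (x - xstar).ofLp) := by
    rw [← ofLp_matrixCLM, ← norm_sq_eq_dotProduct, ← norm_sq_eq_dotProduct]
    exact pow_le_pow_left₀ (norm_nonneg _) hp 2
  have h := two_mul_dotProduct_le_of_lambdaMin hQ hr hp'
  have e : -x + S.proj x = -(x - xstar) + (S.proj x - xstar) := by abel
  rw [e, inner_eq_dotProduct, norm_sq_eq_dotProduct, ofLp_matrixCLM, ofLp_matrixCLM]
  exact h

/-- Nonexpansivity of the impulses in the metric of `Q`. -/
theorem norm_matrixCLM_sub_le {σ Q : Matrix (Fin n) (Fin n) ℝ} (hQ : Q.PosDef) {η : ℝ} (hη : η ≤ 1)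
    (himp : (invSqrt Q * (1 - σ).transpose * Q * (1 - σ) * invSqrt Q
        - η • (1 : Matrix (Fin n) (Fin n) ℝ)) ≤ 0) (v : EuclideanSpace ℝ (Fin n)) :
    ‖matrixCLM (CFC.sqrt Q) (v - Matrix.toEuclideanLin σ v)‖ ≤ ‖matrixCLM (CFC.sqrt Q) v‖ := by
  have h := sq_dotProduct_mulVec_of_loewner hQ hη himp v.ofLp
  have e : Matrix.mulVec (1 - σ) v.ofLp = (v - Matrix.toEuclideanLin σ v).ofLp := by
    rw [Matrix.sub_mulVec, Matrix.one_mulVec]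
    rfl
  rw [e, ← ofLp_matrixCLM, ← ofLp_matrixCLM, ← norm_sq_eq_dotProduct, ← norm_sq_eq_dotProduct] at h
  exact le_of_sq_le_sq h (norm_nonneg _)

end Main

theorem theorem4p1 {n : ℕ} (S : ImpulsiveProjectionNetwork n)
    (xstar : EuclideanSpace ℝ (Fin n)) (hstar : S.IsEquilibrium xstar)
    (σ : Matrix (Fin n) (Fin n) ℝ)
    (hU : ∀ k, 1 ≤ k → k ≤ S.m → ∀ x : EuclideanSpace ℝ (Fin n),
      S.U k x = -(Matrix.toEuclideanLin σ (x - xstar)))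
    (Q : Matrix (Fin n) (Fin n) ℝ) (hQ : Q.PosDef)
    (ρ₁ η₁ : ℝ) (hρ₁ : 0 < ρ₁) (hη₁ : 0 < η₁) (hη₁' : η₁ ≤ 1)
    (hflow : 0 < lambdaMin
      (-(invSqrt Q * (-(2 : ℝ) • Q + ρ₁⁻¹ • Q ^ 2
          + ρ₁ • ((1 - S.ρ • S.A).transpose * (1 - S.ρ • S.A))) * invSqrt Q)))
    (himp : (invSqrt Q * (1 - σ).transpose * Q * (1 - σ) * invSqrt Q
        - η₁ • (1 : Matrix (Fin n) (Fin n) ℝ)) ≤ 0) :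
    S.IsGloballyMittagLefflerStable xstar := by
  set c := lambdaMin (-(invSqrt Q * (-(2 : ℝ) • Q + ρ₁⁻¹ • Q ^ 2
          + ρ₁ • ((1 - S.ρ • S.A).transpose * (1 - S.ρ • S.A))) * invSqrt Q)) with hc
  have hα₀ := S.α_pos
  have hα := S.α_lt_one
  have hG : 0 < Real.Gamma (1 - S.α) := Real.Gamma_pos_of_pos (sub_pos.2 hα)
  -- Γ(1-α) undoes the normalisation of the Caputo derivative; the 1/2 comes from the factor 2 in
  -- `two_mul_inner_le`.
  set μ := Real.Gamma (1 - S.α) * (c / 2) with hμdef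
  have hμ : 0 < μ := by positivity
  set R := matrixCLM (CFC.sqrt Q) with hR
  set R' := matrixCLM (invSqrt Q) with hR'
  have hinv : ∀ v, R' (R v) = v := by
    intro v
    apply WithLp.ofLp_injective
    rw [hR, hR', ofLp_matrixCLM, ofLp_matrixCLM, Matrix.mulVec_mulVec, (sqrt_facts hQ).2.2.1,
      Matrix.one_mulVec]
  obtain ⟨lam, C, hlam, hC, H⟩ := exists_norm_sq_le_mittagLeffler_of_pieces
    (E := EuclideanSpace ℝ (Fin n)) hα₀ hα hμ S.m (S.t_nonneg S.m le_rfl)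
  -- The decay estimate concerns ‖z‖², hence the exponent 1/2 and a quadratic M; the operator norms
  -- convert between x - x* and z = Q^{1/2}(x - x*).
  refine ⟨lam, 1 / 2, fun y => ‖R'‖ ^ 2 * C * ‖R‖ ^ 2 * ‖y‖ ^ 2, hlam, by norm_num,
    (contDiff_const.mul (contDiff_norm_sq ℝ)).locallyLipschitz, by simp,
    fun y => by positivity, ?_⟩
  intro T hT x₀ x hx t ht
  set a := S.node T with ha
  have ha0 : a 0 = 0 := by rw [ha, S.node_of_le T (Nat.zero_le _), S.t_zero]
  have ham : a S.m = S.t S.m := S.node_of_le T le_rfl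
  have hlast : a (S.m + 1) = T := if_neg (by omega)
  have hlt : ∀ k ≤ S.m, a k < a (k + 1) := fun k hk => S.node_lt hT hk
  choose! z hz hzx hz0 hzj using hx.exists_piece hT
  have hTpos : 0 < T := (S.t_nonneg S.m le_rfl).trans_lt hT
  have hsub : ∀ k ≤ S.m, IsPrimitiveOn (deriv x) (fun s => z k s - xstar) (a k) (a (k + 1)) := by
    intro k hk
    refine ⟨(hz k hk).1, fun s hs => ?_⟩
    have h := (hz k hk).2 s hs
    simp only
    rw [h]
    abel
  have hprim : ∀ k ≤ S.m, IsPrimitiveOn (fun s => R (deriv x s)) (fun s => R (z k s - xstar))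
      (a k) (a (k + 1)) := fun k hk => (hsub k hk).clm_apply R
  -- The pointwise derivative is integrable across the impulses, so the Abel integral from 0
  -- converges almost everywhere and commutes with Q^{1/2}.
  have hderiv : IntervalIntegrable (deriv x) volume 0 T := by
    have := IntervalIntegrable.trans_iterate (a := a) (n := S.m + 1) fun k hk =>
      (hz k (by omega)).1
    rwa [ha0, hlast] at this
  have hnodeT : ∀ k ≤ S.m, 0 ≤ a k ∧ a (k + 1) ≤ T := by
    intro k hk
    refine ⟨by rw [ha, S.node_of_le T hk]; exact S.t_nonneg k hk, ?_⟩
    rw [← hlast]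
    have : ∀ j, k + 1 ≤ j → j ≤ S.m + 1 → a (k + 1) ≤ a j := by
      intro j hj
      induction j, hj using Nat.le_induction with
      | base => intro _; exact le_rfl
      | succ i hi ih => intro him; exact (ih (by omega)).trans (hlt i (by omega)).le
    exact this (S.m + 1) (by omega) le_rfl
  have hbound := H a (fun s => R (deriv x s)) (fun k s => R (z k s - xstar)) ha0 ham hlt hprim
    (by
      intro k hk
      have hmem : a (k + 1) ∈ Ioc (a k) (a (k + 1)) := ⟨hlt k hk.le, le_rfl⟩
      have hnode : a (k + 1) = S.t (k + 1) := S.node_of_le T hk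
      have h1 : z (k + 1) (a (k + 1)) - xstar = (x (a (k + 1)) - xstar)
          - Matrix.toEuclideanLin σ (x (a (k + 1)) - xstar) := by
        rw [hnode, hzj (k + 1) hk (by omega), hU (k + 1) (by omega) hk]
        abel
      rw [h1, hzx k hk.le _ hmem]
      exact norm_matrixCLM_sub_le hQ hη₁' himp _)
    (by
      intro k hk
      filter_upwards [(ae_restrict_iff' measurableSet_Icc).1 hx.equation,
        ae_intervalIntegrable_abel hα hTpos.le hderiv] with s h1 h2 hs
      have hs0 : s ∈ Ioo 0 T :=
        ⟨(hnodeT k hk).1.trans_lt hs.1, hs.2.trans_le (hnodeT k hk).2⟩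
      have h3 := h1 (Ioo_subset_Icc_self hs0)
      have h4 : abelIntegral S.α (deriv x) 0 s
          = Real.Gamma (1 - S.α) • (-x s + S.proj (x s)) := by
        rw [← h3, caputoDeriv, smul_inv_smul₀ hG.ne', abelIntegral]
      have h5 : abelIntegral S.α (fun s => R (deriv x s)) 0 s
          = R (abelIntegral S.α (deriv x) 0 s) := by
        rw [abelIntegral, abelIntegral, ← R.intervalIntegral_comp_comm (h2 hs0)]
        simp only [map_smul]
      have h6 := S.two_mul_inner_le hstar hQ hρ₁ (x s)
      rw [← hc] at h6
      rw [h5, h4, map_smul, real_inner_smul_right, hzx k hk s (Ioo_subset_Ioc_self hs)]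
      have h7 := mul_le_mul_of_nonneg_left h6 hG.le
      rw [hμdef]
      linarith)
  have hfinal : ∀ v, ‖R v‖ ^ 2 ≤ C * ‖R (x₀ - xstar)‖ ^ 2 * mittagLeffler S.α (-lam * t ^ S.α) →
      ‖v‖ ≤ (‖R'‖ ^ 2 * C * ‖R‖ ^ 2 * ‖x₀ - xstar‖ ^ 2
        * mittagLeffler S.α (-lam * t ^ S.α)) ^ (1 / 2 : ℝ) := by
    intro v hv
    rw [← Real.sqrt_eq_rpow]
    refine Real.le_sqrt_of_sq_le ?_
    have hE : 0 ≤ mittagLeffler S.α (-lam * t ^ S.α) := by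
      rw [neg_mul]
      exact mittagLeffler_neg_nonneg hα₀ hα (mul_nonneg hlam.le (Real.rpow_nonneg ht.1 _))
    have h1 : ‖v‖ ≤ ‖R'‖ * ‖R v‖ := by
      conv_lhs => rw [← hinv v]
      exact R'.le_opNorm _
    calc ‖v‖ ^ 2 ≤ ‖R'‖ ^ 2 * ‖R v‖ ^ 2 := by
          rw [← mul_pow]; exact pow_le_pow_left₀ (norm_nonneg _) h1 2
      _ ≤ ‖R'‖ ^ 2 * (C * (‖R‖ * ‖x₀ - xstar‖) ^ 2 * mittagLeffler S.α (-lam * t ^ S.α)) := by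
          refine mul_le_mul_of_nonneg_left (hv.trans ?_) (sq_nonneg _)
          gcongr
          exact R.le_opNorm _
      _ = _ := by ring
  refine hfinal _ ?_
  rw [hz0 0 (Nat.zero_le _) rfl] at hbound
  -- Pieces agree with the solution on half-open intervals (t_k, t_{k+1}], so t = 0 is treated
  -- apart; otherwise the piece is the first one whose right endpoint is at least t.
  rcases ht.1.eq_or_lt with rfl | htpos
  · have h := hbound 0 (Nat.zero_le _) 0 ⟨ha0.le, by rw [← ha0]; exact (hlt 0 (Nat.zero_le _)).le⟩
    rw [hz0 0 (Nat.zero_le _) rfl] at h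
    rwa [hx.initial]
  · have hex : ∃ k, t ≤ a (k + 1) := ⟨S.m, by rw [hlast]; exact ht.2⟩
    have hk := Nat.find_spec hex
    have hkm : Nat.find hex ≤ S.m := Nat.find_min' hex (by rw [hlast]; exact ht.2)
    have hkl : a (Nat.find hex) < t := by
      rcases Nat.eq_zero_or_pos (Nat.find hex) with h0 | h0
      · rw [h0, ha0]; exact htpos
      · have := Nat.find_min hex (m := Nat.find hex - 1) (by omega)
        rw [Nat.sub_add_cancel h0] at this
        exact not_le.1 this
    have h := hbound _ hkm t ⟨hkl.le, hk⟩
    rwa [hzx _ hkm t ⟨hkl, hk⟩] at h
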